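/- Let $T=(V,E)$ be a tree with $n=|V|\ge 2$ vertices, given with a plane straight-line drawing: vertices are distinct points of $\mathbb{R}^2$, edges are the straight-line segments between their endpoints, no edge passes through a vertex other than its endpoints, and two distinct edges meet at most in a common endpoint. A curve is *self-approaching* if for every point $c$ on it the Euclidean distance to $c$ does not increase while the curve is traversed from its start to $c$; it is *increasing-chord* if it is self-approaching in both directions. A subtree of $T$ is *increasing-chord* if every two of its vertices are joined in it by a path whose drawing is an increasing-chord curve. Two edge-disjoint subtrees have a *proper contact* at a common vertex $v$ if $v$ is a leaf of at least one of them. Call a partition of $E$ *admissible* if each of its parts is the edge set of an increasing-chord subtree of $T$ and all contacts between distinct parts are proper, and let $\mathrm{OPT}$ be the minimum number of parts of an admissible partition. There is an algorithm that, given the list of edges of $T$ and the coordinates of the vertices, computes an admissible partition of $E$ with at most $2\cdot\mathrm{OPT}-1$ parts in time polynomial in $n$. Here time is the number of operations on a real RAM (exact arithmetic and comparisons on real numbers at unit cost; natural numbers with addition, subtraction and comparison for counting and indirect addressing; only integer constants; no conversion of reals into integers). -/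

import Mathlib

/-! ### Straight-line drawings, increasing-chord subtrees, proper contacts -/

namespace TreeDrawing

/-- The Euclidean plane. -/
abbrev Plane : Type := EuclideanSpace ℝ (Fin 2)

/-- `pos` is a plane straight-line drawing of the graph `G`: distinct vertices are distinct points,
an edge (drawn as a segment) passes through no vertex other than its endpoints, and two distinct
edges have no common point except a common endpoint. -/
structure IsPlaneDrawing {V : Type*} (G : SimpleGraph V) (pos : V → Plane) : Prop where
  injective : Function.Injective pos
  vertex_on_edge : ∀ u v w : V, G.Adj u v → pos w ∈ segment ℝ (pos u) (pos v) → w = u ∨ w = v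
  edge_inter_edge : ∀ u v x y : V, G.Adj u v → G.Adj x y → s(u, v) ≠ s(x, y) →
    ∀ p : Plane, p ∈ segment ℝ (pos u) (pos v) → p ∈ segment ℝ (pos x) (pos y) →
      ∃ w : V, w ∈ s(u, v) ∧ w ∈ s(x, y) ∧ p = pos w

/-- The polygonal curve that draws a walk `v₀ v₁ … v_ℓ`, parametrised by `[0, ℓ]`: at time `i + r`
with `0 ≤ r < 1` it is at `(1 - r) • pos vᵢ + r • pos vᵢ₊₁`. -/
noncomputable def walkCurve {V : Type*} {G : SimpleGraph V} (pos : V → Plane) {u v : V}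
    (w : G.Walk u v) (t : ℝ) : Plane :=
  AffineMap.lineMap (pos (w.getVert ⌊t⌋₊)) (pos (w.getVert (⌊t⌋₊ + 1))) (Int.fract t)

/-- A curve on `[0, L]` is self-approaching: for every point `γ c` of it, the distance to `γ c`
does not increase while the curve is traversed from its start to `γ c`. -/
def IsSelfApproaching (γ : ℝ → Plane) (L : ℝ) : Prop :=
  ∀ c ∈ Set.Icc 0 L, AntitoneOn (fun t => dist (γ t) (γ c)) (Set.Icc 0 c)

/-- A curve on `[0, L]` has increasing chords: it is self-approaching in both directions. -/
def IsIncreasingChordCurve (γ : ℝ → Plane) (L : ℝ) : Prop :=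
  IsSelfApproaching γ L ∧ IsSelfApproaching (fun t => γ (L - t)) L

/-- A straight-line drawing of a graph is increasing-chord: every two vertices are joined by a path
whose drawing is an increasing-chord curve. -/
def IsIncreasingChordDrawing {V : Type*} (G : SimpleGraph V) (pos : V → Plane) : Prop :=
  ∀ u v : V, ∃ w : G.Walk u v, w.IsPath ∧ IsIncreasingChordCurve (walkCurve pos w) w.length

/-- The vertices incident to an edge of `F`. -/
abbrev partVerts {V : Type*} (F : Finset (Sym2 V)) : Set V :=
  (SimpleGraph.fromEdgeSet (F : Set (Sym2 V))).support

/-- The graph formed by the edges in `F` and their endpoints. -/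
abbrev partGraph {V : Type*} (F : Finset (Sym2 V)) : SimpleGraph (partVerts F) :=
  (SimpleGraph.fromEdgeSet (F : Set (Sym2 V))).induce (partVerts F)

/-- The edges in `F` form a tree whose drawing is increasing-chord. -/
def IsIncreasingChordSubtree {V : Type*} (pos : V → Plane) (F : Finset (Sym2 V)) : Prop :=
  (partGraph F).IsTree ∧ IsIncreasingChordDrawing (partGraph F) (fun v => pos v.1)

/-- `v` is a leaf of the subtree formed by the edges in `F`. -/
def IsLeafOf {V : Type*} (F : Finset (Sym2 V)) (v : V) : Prop :=
  ((SimpleGraph.fromEdgeSet (F : Set (Sym2 V))).neighborSet v).ncard = 1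

/-- Every contact of two parts of a plane drawing (that is, every common vertex) is proper:
the common vertex is a leaf in at least one of the two. -/
def ProperContact {V : Type*} (F₁ F₂ : Finset (Sym2 V)) : Prop :=
  ∀ v : V, v ∈ partVerts F₁ → v ∈ partVerts F₂ → IsLeafOf F₁ v ∨ IsLeafOf F₂ v

/-- A partition of the edges of `G` into increasing-chord subtrees that have only proper
contacts. -/
def IsProperDecomposition {V : Type*} [DecidableEq V] {G : SimpleGraph V} [Fintype G.edgeSet]
    (pos : V → Plane) (P : Finpartition G.edgeFinset) : Prop :=
  (∀ F ∈ P.parts, IsIncreasingChordSubtree pos F) ∧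
    ∀ F₁ ∈ P.parts, ∀ F₂ ∈ P.parts, F₁ ≠ F₂ → ProperContact F₁ F₂

/-- The minimum number of parts of a partition of the edges into increasing-chord subtrees with
only proper contacts. -/
noncomputable def optSize {V : Type*} [DecidableEq V] (G : SimpleGraph V) [Fintype G.edgeSet]
    (pos : V → Plane) : ℕ :=
  sInf {k : ℕ | ∃ P : Finpartition G.edgeFinset, IsProperDecomposition pos P ∧ P.parts.card = k}

end TreeDrawing

/-! ### Programs for a real RAM

The machine has natural-number variables and unbounded arrays, used for counting and addressing,
and unbounded arrays of real numbers. Naturals admit addition, truncated subtraction and comparison;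
reals admit the four field operations and comparison, each exact and at unit cost. Programs contain
only integer constants, and a real number is never converted into a natural number. -/

namespace RealRAM

/-- Expressions for natural numbers; `read a i` is the `i`-th cell of array number `a`. -/
inductive NExp : Type
  | const (c : ℕ)
  | var (x : ℕ)
  | read (a : ℕ) (i : NExp)
  | add (e f : NExp)
  | sub (e f : NExp)

/-- Expressions for real numbers; `read a i` is the `i`-th cell of the real array number `a`. -/
inductive RExp : Type
  | const (c : ℤ)
  | read (a : ℕ) (i : NExp)
  | add (e f : RExp)
  | sub (e f : RExp)
  | mul (e f : RExp)
  | div (e f : RExp)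

/-- Tests: comparisons of naturals and of reals, and their Boolean combinations. -/
inductive Test : Type
  | nle (e f : NExp)
  | rle (e f : RExp)
  | neg (b : Test)
  | conj (b c : Test)

/-- Programs. -/
inductive Cmd : Type
  | skip
  | setVar (x : ℕ) (e : NExp)
  | setNat (a : ℕ) (i e : NExp)
  | setReal (a : ℕ) (i : NExp) (e : RExp)
  | seq (p q : Cmd)
  | ite (b : Test) (p q : Cmd)
  | loop (b : Test) (p : Cmd)

/-- The contents of the memory. -/
structure State : Type where
  nvar : ℕ → ℕ
  narr : ℕ → ℕ → ℕ
  rarr : ℕ → ℕ → ℝ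

/-- The value of an expression. -/
def NExp.val (s : State) : NExp → ℕ
  | const c => c
  | var x => s.nvar x
  | read a i => s.narr a (i.val s)
  | add e f => e.val s + f.val s
  | sub e f => e.val s - f.val s

/-- The number of elementary operations needed to evaluate an expression. -/
def NExp.cost : NExp → ℕ
  | const _ => 1
  | var _ => 1
  | read _ i => i.cost + 1
  | add e f => e.cost + f.cost + 1
  | sub e f => e.cost + f.cost + 1

/-- The value of an expression (the quotient by zero is zero). -/
noncomputable def RExp.val (s : State) : RExp → ℝ
  | const c => (c : ℝ)
  | read a i => s.rarr a (i.val s)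
  | add e f => e.val s + f.val s
  | sub e f => e.val s - f.val s
  | mul e f => e.val s * f.val s
  | div e f => e.val s / f.val s

/-- The number of elementary operations needed to evaluate an expression. -/
def RExp.cost : RExp → ℕ
  | const _ => 1
  | read _ i => i.cost + 1
  | add e f => e.cost + f.cost + 1
  | sub e f => e.cost + f.cost + 1
  | mul e f => e.cost + f.cost + 1
  | div e f => e.cost + f.cost + 1

/-- The test succeeds. -/
def Test.Holds (s : State) : Test → Prop
  | nle e f => e.val s ≤ f.val s
  | rle e f => e.val s ≤ f.val s
  | neg b => ¬ b.Holds s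
  | conj b c => b.Holds s ∧ c.Holds s

/-- The number of elementary operations needed to evaluate a test. -/
def Test.cost : Test → ℕ
  | nle e f => e.cost + f.cost + 1
  | rle e f => e.cost + f.cost + 1
  | neg b => b.cost + 1
  | conj b c => b.cost + c.cost + 1

/-- `Exec p s t s'`: started in the state `s`, the program `p` halts after exactly `t` elementary
operations, and the memory is then `s'`. -/
inductive Exec : Cmd → State → ℕ → State → Prop
  | skip (s : State) : Exec .skip s 1 s
  | setVar (s : State) (x : ℕ) (e : NExp) :
      Exec (.setVar x e) s (e.cost + 1)
        { s with nvar := Function.update s.nvar x (e.val s) }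
  | setNat (s : State) (a : ℕ) (i e : NExp) :
      Exec (.setNat a i e) s (i.cost + e.cost + 1)
        { s with narr := Function.update s.narr a
                   (Function.update (s.narr a) (i.val s) (e.val s)) }
  | setReal (s : State) (a : ℕ) (i : NExp) (e : RExp) :
      Exec (.setReal a i e) s (i.cost + e.cost + 1)
        { s with rarr := Function.update s.rarr a
                   (Function.update (s.rarr a) (i.val s) (e.val s)) }
  | seq {p q : Cmd} {s s' s'' : State} {t t' : ℕ} :
      Exec p s t s' → Exec q s' t' s'' → Exec (.seq p q) s (t + t') s''
  | ite_true {b : Test} {p q : Cmd} {s s' : State} {t : ℕ} :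
      b.Holds s → Exec p s t s' → Exec (.ite b p q) s (b.cost + t) s'
  | ite_false {b : Test} {p q : Cmd} {s s' : State} {t : ℕ} :
      ¬ b.Holds s → Exec q s t s' → Exec (.ite b p q) s (b.cost + t) s'
  | loop_true {b : Test} {p : Cmd} {s s' s'' : State} {t t' : ℕ} :
      b.Holds s → Exec p s t s' → Exec (.loop b p) s' t' s'' →
        Exec (.loop b p) s (b.cost + t + t') s''
  | loop_false {b : Test} {p : Cmd} {s : State} :
      ¬ b.Holds s → Exec (.loop b p) s b.cost s

/-- The input: variable `0` holds the number `n` of vertices, the natural arrays `0` and `1` hold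
the two endpoints of the edges in the order in which the edges are listed, the real arrays `0` and
`1` hold the two coordinates of the vertices, and all other memory is zero. -/
noncomputable def inputState (n : ℕ) {m : ℕ} (ends : Fin m → Fin n × Fin n)
    (pos : Fin n → TreeDrawing.Plane) : State where
  nvar x := if x = 0 then n else 0
  narr a i :=
    if h : i < m then
      if a = 0 then (ends ⟨i, h⟩).1 else if a = 1 then (ends ⟨i, h⟩).2 else 0
    else 0
  rarr a v :=
    if h : v < n then
      if a = 0 then pos ⟨v, h⟩ 0 else if a = 1 then pos ⟨v, h⟩ 1 else 0
    else 0

/-- The output: the `i`-th cell of the natural array `2` is the label of the part that contains the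
`i`-th edge of the list, so that two edges have the same label exactly if they lie in the same part
of the partition `P`. -/
def OutputsPartition {V : Type*} [DecidableEq V] {m : ℕ} (s : State) (ends : Fin m → V × V)
    {E : Finset (Sym2 V)} (P : Finpartition E) : Prop :=
  ∀ i j : Fin m, s.narr 2 i = s.narr 2 j ↔
    ∃ F ∈ P.parts, s((ends i).1, (ends i).2) ∈ F ∧ s((ends j).1, (ends j).2) ∈ F

end RealRAM

/-! ### Polygonal curves -/

namespace TreeDrawing

open SimpleGraph

/-! While an edge is traversed towards its end `b`, the distance to a point `q` never increases
exactly when `q` lies beyond the normal of the edge at `b`. Hence the drawing of a path is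
increasing-chord if and only if, for any two of its edges, both ends of one lie on the same side of
the strip spanned by the normals at the ends of the other (`SameSide`). A subtree is therefore
increasing-chord as soon as no two of its edges are in conflict;
`sameSide_of_isIncreasingChordDrawing` and `isIncreasingChordDrawing_of_sameSide` give the two
directions.

Subdivide every edge of the tree by a node that stands for this edge. A set `C` of links of the
subdivided tree splits its nodes, and thereby the edges of the original tree, into at most `|C| + 1`
classes. Each class forms a subtree. A vertex is a leaf of every class containing it, except
possibly the class of its own node, so all contacts are proper (`isLeafOf_fibre`). If `C` separates
all conflicting pairs, the partition is admissible.

Conversely, an admissible partition into `k` parts has `n - 1 + k` incidences between vertices and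
parts. Giving each vertex the colour of one main part, such that it is a leaf of the others, leaves
`k - 1` other incidences, and the bichromatic links inject into these (`exists_colouring`).

What remains is a multicut problem in a tree, which a greedy method solves within a factor 2. The
nodes `z` are visited in decreasing order, so children come before parents. Whenever two conflicting
nodes can both still climb to `z`, the last link of each climb is cut. Any valid colouring has a
bichromatic link on one of the two climbs. This link was connected to the root before, since there
are no cuts between `z` and the root, and is separated from it afterwards. So each round of at most
two cuts is charged to a new bichromatic link (`GreedyInv.cut`). This gives `|C| ≤ 2 * (OPT - 1)`
and at most `2 * OPT - 1` parts (`greedy_approximation`).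

The program numbers the vertices by repeated passes over the edge list, runs the greedy method over
all nodes and all pairs of edges, and propagates labels from the root. Loop invariants prove that it
does so in polynomial time (`runs_decompose`). -/

/-- The polygonal curve through the points `p 0, p 1, …`, which is at `p i` at time `i`. -/
noncomputable def polyline (p : ℕ → Plane) (t : ℝ) : Plane :=
  AffineMap.lineMap (p ⌊t⌋₊) (p (⌊t⌋₊ + 1)) (Int.fract t)

/-- The right end is included although the floor jumps there: both formulas give the common vertex.
Closed pieces are what the gluing of monotone functions needs. -/
theorem polyline_eq_lineMap (p : ℕ → Plane) {i : ℕ} {t : ℝ} (h₀ : (i : ℝ) ≤ t) (h₁ : t ≤ i + 1) :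
    polyline p t = AffineMap.lineMap (p i) (p (i + 1)) (t - i) := by
  have ht : 0 ≤ t := le_trans (Nat.cast_nonneg i) h₀
  rcases h₁.lt_or_eq with h | rfl
  · have hf : ⌊t⌋₊ = i := (Nat.floor_eq_iff ht).2 ⟨h₀, h⟩
    have hr : Int.fract t = t - i := by
      rw [← hf, ← Int.self_sub_floor, natCast_floor_eq_intCast_floor ht]
    rw [polyline, hf, hr]
  · have hf : ⌊(i : ℝ) + 1⌋₊ = i + 1 := by exact_mod_cast Nat.floor_natCast (R := ℝ) (i + 1)
    have hr : Int.fract ((i : ℝ) + 1) = 0 := by simp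
    rw [polyline, hf, hr]
    simp

theorem polyline_natCast (p : ℕ → Plane) (i : ℕ) : polyline p i = p i := by
  simp [polyline]

/-- An expansion in the remaining time `1 - r`: if the inner product is nonnegative, so are all
coefficients, which yields monotonicity at once. -/
theorem dist_lineMap_sq (a b q : Plane) (r : ℝ) : dist (AffineMap.lineMap a b r) q ^ 2 =
    ‖q - b‖ ^ 2 + 2 * (1 - r) * inner ℝ (q - b) (b - a) + (1 - r) ^ 2 * ‖b - a‖ ^ 2 := by
  have : AffineMap.lineMap a b r - q = -((q - b) + (1 - r) • (b - a)) := by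
    rw [AffineMap.lineMap_apply_module']; module
  rw [dist_eq_norm, this, norm_neg, norm_add_sq_real, norm_smul, inner_smul_right, mul_pow,
    Real.norm_eq_abs, sq_abs]
  ring

/-- Moving along a segment towards its end `b` does not increase the distance to a point `q` that
lies beyond `b`. -/
theorem dist_lineMap_antitoneOn {a b q : Plane} (h : 0 ≤ inner ℝ (q - b) (b - a)) :
    AntitoneOn (fun t : ℝ => dist (AffineMap.lineMap a b t) q) (Set.Icc 0 1) := by
  intro s hs t ht hst
  refine le_of_sq_le_sq ?_ dist_nonneg
  rw [dist_lineMap_sq, dist_lineMap_sq]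
  have h1 : (1 - t) ^ 2 ≤ (1 - s) ^ 2 := by nlinarith [ht.2, hs.2]
  have h2 := mul_le_mul_of_nonneg_right h1 (sq_nonneg ‖b - a‖)
  nlinarith [mul_nonneg (sub_nonneg.2 hst) h]

/-- The inner product is, up to a negative factor, the derivative of the squared distance at the end
of the segment. A negative value would let the distance increase just before the end. -/
theorem inner_nonneg_of_antitoneOn {a b q : Plane}
    (h : AntitoneOn (fun t : ℝ => dist (AffineMap.lineMap a b t) q) (Set.Icc 0 1)) :
    0 ≤ inner ℝ (q - b) (b - a) := by
  by_contra hneg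
  push Not at hneg
  set g : ℝ := inner ℝ (q - b) (b - a) with hg
  set N : ℝ := ‖b - a‖ ^ 2 with hN
  have hN0 : 0 ≤ N := sq_nonneg _
  have main : ∀ ε : ℝ, 0 < ε → ε ≤ 1 → 0 ≤ 2 * g + ε * N := by
    intro ε h0 h1
    have hle := h (a := 1 - ε) ⟨by linarith, by linarith⟩ (b := 1) ⟨by norm_num, le_rfl⟩
      (by linarith)
    have hsq := pow_le_pow_left₀ dist_nonneg hle 2
    simp only [dist_lineMap_sq] at hsq
    have : 0 ≤ ε * (2 * g + ε * N) := by nlinarith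
    exact nonneg_of_mul_nonneg_right this h0
  -- This `ε` satisfies `ε * N ≤ -g`, so `2 * g + ε * N ≤ g < 0`; the denominator is positive even
  -- for `N = 0`.
  have h1 : 0 < -g / (N - g) := div_pos (by linarith) (by linarith)
  have h2 : -g / (N - g) ≤ 1 := (div_le_one (by linarith)).2 (by linarith)
  have h3 := main _ h1 h2
  have h4 : -g / (N - g) * N ≤ -g := by
    rw [div_mul_eq_mul_div, div_le_iff₀ (by linarith)]
    nlinarith
  linarith

/-- A polygonal curve is self-approaching if every vertex that follows an edge lies beyond the end
of that edge. -/
theorem isSelfApproaching_polyline {p : ℕ → Plane} {L : ℕ}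
    (h : ∀ i < L, ∀ j, i + 1 ≤ j → 0 ≤ inner ℝ (p j - p (i + 1)) (p (i + 1) - p i)) :
    IsSelfApproaching (polyline p) L := by
  rintro c ⟨hc0, hcL⟩
  set q := polyline p c with hq
  -- If `c` lies in the piece, the distance is linear in the time left until `c`. If the piece ends
  -- before `c`, the target is a convex combination of two vertices beyond the edge, hence beyond it
  -- too.
  have piece : ∀ i : ℕ, AntitoneOn (fun t => dist (polyline p t) q)
      (Set.Icc (i : ℝ) (min (i + 1) c)) := by
    intro i
    by_cases hic : (i : ℝ) ≤ c
    swap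
    · rw [Set.Icc_eq_empty (fun hh => hic (hh.trans (min_le_right _ _)))]
      exact fun x hx => absurd hx (by simp)
    by_cases hci : c ≤ (i : ℝ) + 1
    · rintro s ⟨hs0, hs1⟩ t ⟨ht0, ht1⟩ hst
      have e : ∀ r : ℝ, (i : ℝ) ≤ r → r ≤ min ((i : ℝ) + 1) c →
          dist (polyline p r) q = (c - r) * dist (p i) (p (i + 1)) := by
        intro r h0 h1
        have hrc : r ≤ c := h1.trans (min_le_right _ _)
        rw [hq, polyline_eq_lineMap p h0 (h1.trans (min_le_left _ _)),
          polyline_eq_lineMap p hic hci, dist_lineMap_lineMap, Real.dist_eq, abs_sub_comm,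
          abs_of_nonneg (by linarith)]
        ring
      simp only [e s hs0 hs1, e t ht0 ht1]
      exact mul_le_mul_of_nonneg_right (by linarith) dist_nonneg
    · push Not at hci
      rw [min_eq_left hci.le]
      have hiL : i < L := by
        have : (i : ℝ) < L := by linarith
        exact_mod_cast this
      have hk : i + 1 ≤ ⌊c⌋₊ := Nat.le_floor (by push_cast; exact hci.le)
      have hin : 0 ≤ inner ℝ (q - p (i + 1)) (p (i + 1) - p i) := by
        have h1 := h i hiL _ hk
        -- For `c = L` this is the vertex with index `L + 1`, which is why the hypothesis puts no
        -- upper bound on `j`.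
        have h2 := h i hiL (⌊c⌋₊ + 1) (by omega)
        have e : q - p (i + 1) = (1 - Int.fract c) • (p ⌊c⌋₊ - p (i + 1)) +
            Int.fract c • (p (⌊c⌋₊ + 1) - p (i + 1)) := by
          rw [hq, polyline, AffineMap.lineMap_apply_module]; module
        rw [e, inner_add_left, inner_smul_left, inner_smul_left]
        have := Int.fract_lt_one c
        have := Int.fract_nonneg c
        simp only [conj_trivial]
        exact add_nonneg (mul_nonneg (by linarith) h1) (mul_nonneg (by linarith) h2)
      rintro s ⟨hs0, hs1⟩ t ⟨ht0, ht1⟩ hst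
      have hs : s - (i : ℝ) ∈ Set.Icc (0 : ℝ) 1 := ⟨by linarith, by linarith⟩
      have ht : t - (i : ℝ) ∈ Set.Icc (0 : ℝ) 1 := ⟨by linarith, by linarith⟩
      have := dist_lineMap_antitoneOn hin hs ht (by linarith)
      simpa only [polyline_eq_lineMap p hs0 hs1, polyline_eq_lineMap p ht0 ht1] using this
  have glue : ∀ k : ℕ, AntitoneOn (fun t => dist (polyline p t) q)
      (Set.Icc 0 (min (k : ℝ) c)) := by
    intro k
    induction k with
    | zero =>
      rw [Nat.cast_zero, min_eq_left hc0, Set.Icc_self]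
      exact fun x hx y hy _ => by rw [Set.mem_singleton_iff.1 hx, Set.mem_singleton_iff.1 hy]
    | succ k ih =>
      by_cases hkc : (k : ℝ) ≤ c
      · rw [min_eq_left hkc] at ih
        have hk0 : (0 : ℝ) ≤ k := Nat.cast_nonneg k
        have hkm : (k : ℝ) ≤ min ((k : ℝ) + 1) c := le_min (by linarith) hkc
        have := ih.union_right (piece k) (isGreatest_Icc hk0) (isLeast_Icc hkm)
        rwa [Set.Icc_union_Icc_eq_Icc hk0 hkm, ← Nat.cast_succ] at this
      · push Not at hkc
        rw [min_eq_right (by push_cast; linarith)]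
        rwa [min_eq_right hkc.le] at ih
  have := glue L
  rwa [min_eq_right hcL] at this

/-- The last vertex of a self-approaching polygonal curve lies beyond the end of the first edge. -/
theorem inner_nonneg_of_isSelfApproaching {p : ℕ → Plane} {L : ℕ} (hL : 1 ≤ L)
    (h : IsSelfApproaching (polyline p) L) : 0 ≤ inner ℝ (p L - p 1) (p 1 - p 0) := by
  have h1 : (1 : ℝ) ≤ L := by exact_mod_cast hL
  have hL' := h L ⟨by linarith, le_rfl⟩
  apply inner_nonneg_of_antitoneOn
  intro s hs t ht hst
  have := hL' (a := s) ⟨hs.1, hs.2.trans h1⟩ (b := t) ⟨ht.1, ht.2.trans h1⟩ hst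
  have e : ∀ r ∈ Set.Icc (0 : ℝ) 1, polyline p r = AffineMap.lineMap (p 0) (p 1) r := by
    intro r hr
    rw [polyline_eq_lineMap p (i := 0) (by simpa using hr.1) (by simpa using hr.2)]
    simp
  simpa only [e s hs, e t ht, polyline_natCast] using this

/-! ### Drawings of walks and their reversals -/

theorem walkCurve_eq_polyline {V : Type*} {G : SimpleGraph V} (pos : V → Plane) {u v : V}
    (w : G.Walk u v) : walkCurve pos w = polyline (fun i => pos (w.getVert i)) := rfl

theorem walkCurve_length_sub {V : Type*} {G : SimpleGraph V} (pos : V → Plane) {u v : V}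
    (w : G.Walk u v) {t : ℝ} (h₀ : 0 ≤ t) (h₁ : t ≤ w.length) :
    walkCurve pos w (w.length - t) = walkCurve pos w.reverse t := by
  rw [walkCurve_eq_polyline, walkCurve_eq_polyline]
  rcases h₁.lt_or_eq with h | rfl
  · have hf : ⌊t⌋₊ < w.length := (Nat.floor_lt h₀).2 h
    set i := ⌊t⌋₊ with hi
    have hi0 : (i : ℝ) ≤ t := Nat.floor_le h₀
    have hi1 : t ≤ i + 1 := (Nat.lt_floor_add_one t).le
    obtain ⟨k, hk⟩ : ∃ k, w.length = i + 1 + k := Nat.exists_eq_add_of_le hf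
    have hkc : (w.length : ℝ) = i + 1 + k := by exact_mod_cast hk
    rw [polyline_eq_lineMap _ hi0 hi1, polyline_eq_lineMap _ (i := k) (by linarith) (by linarith)]
    simp only [Walk.getVert_reverse]
    rw [show w.length - i = k + 1 by omega, show w.length - (i + 1) = k by omega,
      ← AffineMap.lineMap_apply_one_sub]
    congr 1
    linarith
  · rw [sub_self]
    have := polyline_natCast (fun i => pos (w.getVert i)) 0
    rw [Nat.cast_zero] at this
    rw [this, polyline_natCast, Walk.getVert_reverse]
    simp

theorem isIncreasingChordCurve_walkCurve_iff {V : Type*} {G : SimpleGraph V} (pos : V → Plane)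
    {u v : V} (w : G.Walk u v) : IsIncreasingChordCurve (walkCurve pos w) w.length ↔
      IsSelfApproaching (walkCurve pos w) w.length ∧
        IsSelfApproaching (walkCurve pos w.reverse) w.reverse.length := by
  rw [IsIncreasingChordCurve, Walk.length_reverse]
  refine and_congr_right fun _ => forall₂_congr fun c hc => ?_
  have e : ∀ t ∈ Set.Icc (0 : ℝ) c, dist (walkCurve pos w (w.length - t))
      (walkCurve pos w (w.length - c)) =
      dist (walkCurve pos w.reverse t) (walkCurve pos w.reverse c) := by
    intro t ht
    rw [walkCurve_length_sub pos w ht.1 (ht.2.trans hc.2), walkCurve_length_sub pos w hc.1 hc.2]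
  exact ⟨fun hh => hh.congr e, fun hh => hh.congr fun t ht => (e t ht).symm⟩

/-! ### Conflicting edges -/

/-- The open strip between the normals of the segment `u v` at its endpoints does not separate `x`
from `y` and contains none of them. -/
def SameSide (u v x y : Plane) : Prop :=
  (0 ≤ inner ℝ (x - v) (v - u) ∧ 0 ≤ inner ℝ (y - v) (v - u)) ∨
    (0 ≤ inner ℝ (x - u) (u - v) ∧ 0 ≤ inner ℝ (y - u) (u - v))

theorem SameSide.swap_left {u v x y : Plane} (h : SameSide u v x y) : SameSide v u x y := Or.symm h

theorem SameSide.swap_right {u v x y : Plane} (h : SameSide u v x y) : SameSide u v y x :=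
  h.imp And.symm And.symm

/-- Along a path without conflicting edges, every vertex after an edge lies beyond it. -/
theorem isSelfApproaching_of_sameSide {V : Type*} {G : SimpleGraph V} {pos : V → Plane}
    (hpos : Function.Injective pos)
    (hG : ∀ a b c d, G.Adj a b → G.Adj c d → s(a, b) ≠ s(c, d) →
      SameSide (pos a) (pos b) (pos c) (pos d)) {u v : V} {w : G.Walk u v} (hw : w.IsPath) :
    IsSelfApproaching (walkCurve pos w) w.length := by
  rw [walkCurve_eq_polyline]
  apply isSelfApproaching_polyline
  intro i hi j hj
  induction j, hj using Nat.le_induction with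
  | base => simp
  | succ j hj ih =>
    by_cases hjL : j < w.length
    swap
    · rw [w.getVert_of_length_le (by omega : w.length ≤ j)] at ih
      rwa [w.getVert_of_length_le (by omega : w.length ≤ j + 1)]
    have hadj := w.adj_getVert_succ hi
    have inj := hw.getVert_injOn
    have hne : s(w.getVert i, w.getVert (i + 1)) ≠ s(w.getVert j, w.getVert (j + 1)) := by
      intro he
      rcases Sym2.eq_iff.1 he with ⟨h1, _⟩ | ⟨h1, _⟩
      · have := inj (show i ≤ w.length by omega) (show j ≤ w.length by omega) h1
        omega
      · have := inj (show i ≤ w.length by omega) (show j + 1 ≤ w.length by omega) h1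
        omega
    rcases hG _ _ _ _ hadj (w.adj_getVert_succ hjL) hne with h | h
    · exact h.2
    -- By induction the vertex `j` is not before the end of the edge `i`, hence strictly past its
    -- start, whereas the other alternative puts it behind the start.
    · exfalso
      have h1 := h.1
      have hd : pos (w.getVert (i + 1)) - pos (w.getVert i) ≠ 0 :=
        sub_ne_zero.2 (hpos.ne hadj.ne')
      have hpd := real_inner_self_pos.2 hd
      have e1 : pos (w.getVert j) - pos (w.getVert i) = (pos (w.getVert j) -
          pos (w.getVert (i + 1))) + (pos (w.getVert (i + 1)) - pos (w.getVert i)) := by abel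
      rw [← neg_sub (pos (w.getVert (i + 1))), inner_neg_right, e1, inner_add_left] at h1
      linarith

/-- The end `w` of an increasing-chord path that starts with the edge `u v` lies beyond `v`. -/
theorem inner_nonneg_of_isIncreasingChordDrawing {V : Type*} {H : SimpleGraph V} {pos : V → Plane}
    (hH : H.IsAcyclic) (hI : IsIncreasingChordDrawing H pos) {u v w : V} (huv : H.Adj u v)
    (hw : (H.deleteEdges {s(u, v)}).Reachable v w) :
    0 ≤ inner ℝ (pos w - pos v) (pos v - pos u) := by
  classical
  obtain ⟨p, hp⟩ := hw.exists_isPath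
  -- Otherwise `u` and `v` would stay connected without the edge between them, which is a bridge.
  have hu : u ∉ p.support := by
    intro hu
    have hb := isAcyclic_iff_forall_adj_isBridge.1 hH huv
    rw [isBridge_iff] at hb
    exact hb ((p.takeUntil u hu).reachable.symm)
  have hpath : (Walk.cons huv (p.mapLe (deleteEdges_le _))).IsPath := by
    rw [Walk.cons_isPath_iff]
    refine ⟨hp.mapLe _, ?_⟩
    simpa using hu
  obtain ⟨π, hπ, hc⟩ := hI u w
  -- Paths in a forest are unique, so the increasing-chord path is the one just built, whose first
  -- edge is `u v`.
  have he : π = Walk.cons huv (p.mapLe (deleteEdges_le _)) :=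
    congrArg Subtype.val ((hH.subsingleton_path u w).elim ⟨π, hπ⟩ ⟨_, hpath⟩)
  subst he
  have h1 := ((isIncreasingChordCurve_walkCurve_iff pos _).1 hc).1
  rw [walkCurve_eq_polyline] at h1
  have h2 := inner_nonneg_of_isSelfApproaching (by simp) h1
  simp only [Walk.getVert_length] at h2
  simpa using h2

/-- Without the edge `u v` the tree falls into the components of `u` and of `v`. The other edge lies
within one of them, and everything in that component is beyond the corresponding end. -/
theorem sameSide_of_isIncreasingChordDrawing {V : Type*} {H : SimpleGraph V} {pos : V → Plane}
    (hH : H.IsTree) (hI : IsIncreasingChordDrawing H pos) {u v x y : V} (huv : H.Adj u v)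
    (hxy : H.Adj x y) (hne : s(u, v) ≠ s(x, y)) : SameSide (pos u) (pos v) (pos x) (pos y) := by
  have hadj : (H.deleteEdges {s(u, v)}).Adj x y := by
    rw [deleteEdges_adj]
    exact ⟨hxy, fun h => hne h.symm⟩
  have key : ∀ a b : V, H.Walk a b → b = v → (H.deleteEdges {s(u, v)}).Reachable v a ∨
      (H.deleteEdges {s(u, v)}).Reachable u a := by
    intro a b p
    induction p with
    | nil => rintro rfl; exact Or.inl (Reachable.refl _)
    | @cons a c b h p ih =>
      intro hb
      by_cases hac : s(a, c) = s(u, v)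
      · rcases Sym2.eq_iff.1 hac with ⟨rfl, _⟩ | ⟨rfl, _⟩
        · exact Or.inr (Reachable.refl _)
        · exact Or.inl (Reachable.refl _)
      · have hac' : (H.deleteEdges {s(u, v)}).Adj c a := by
          rw [adj_comm, deleteEdges_adj]
          exact ⟨h, hac⟩
        exact (ih hb).imp (·.trans hac'.reachable) (·.trans hac'.reachable)
  obtain ⟨p⟩ := hH.connected.preconnected x v
  rcases key x v p rfl with h | h
  · exact Or.inl ⟨inner_nonneg_of_isIncreasingChordDrawing hH.isAcyclic hI huv h,
      inner_nonneg_of_isIncreasingChordDrawing hH.isAcyclic hI huv (h.trans hadj.reachable)⟩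
  · refine Or.inr ⟨inner_nonneg_of_isIncreasingChordDrawing hH.isAcyclic hI huv.symm ?_,
      inner_nonneg_of_isIncreasingChordDrawing hH.isAcyclic hI huv.symm ?_⟩
    · rwa [Sym2.eq_swap]
    · rw [Sym2.eq_swap]
      exact h.trans hadj.reachable

theorem isIncreasingChordDrawing_of_sameSide {V : Type*} {H : SimpleGraph V} {pos : V → Plane}
    (hpos : Function.Injective pos) (hH : H.Connected)
    (h : ∀ a b c d, H.Adj a b → H.Adj c d → s(a, b) ≠ s(c, d) →
      SameSide (pos a) (pos b) (pos c) (pos d)) : IsIncreasingChordDrawing H pos := by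
  intro u v
  obtain ⟨p, hp⟩ := (hH.preconnected u v).exists_isPath
  exact ⟨p, hp, (isIncreasingChordCurve_walkCurve_iff pos p).2
    ⟨isSelfApproaching_of_sameSide hpos h hp,
      isSelfApproaching_of_sameSide hpos h hp.reverse⟩⟩

end TreeDrawing

/-! ### Multicuts in rooted trees

The nodes of a rooted tree are natural numbers, `0` is the root, and the parent `p x` of a node
`x ≠ 0` is smaller than `x`. A node stands also for the edge to its parent, so that a set of edges
is a finite set of nodes; the root may occur in such a set without any effect. -/

namespace TreeMulticut

open Finset

/-- `b` is reached from `a` by moving to parents, using no edge of `C`. -/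
inductive Climb (p : ℕ → ℕ) (C : Finset ℕ) : ℕ → ℕ → Prop
  | refl (a : ℕ) : Climb p C a a
  | step {a b : ℕ} : 0 < a → a ∉ C → Climb p C (p a) b → Climb p C a b

/-- `z` is reached from `a` by moving to parents, using no edge of `C`, and the last edge of this
path is `c`. -/
inductive ClimbLast (p : ℕ → ℕ) (C : Finset ℕ) (z : ℕ) : ℕ → ℕ → Prop
  | base {a : ℕ} : 0 < a → a ∉ C → p a = z → ClimbLast p C z a a
  | step {a c : ℕ} : 0 < a → a ∉ C → ClimbLast p C z (p a) c → ClimbLast p C z a c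

variable {p : ℕ → ℕ} {C C' : Finset ℕ}

theorem Climb.trans {a b c : ℕ} (h : Climb p C a b) (h' : Climb p C b c) : Climb p C a c := by
  induction h with
  | refl => exact h'
  | step h0 h1 _ ih => exact .step h0 h1 (ih h')

theorem Climb.anti {a b : ℕ} (hC : C ⊆ C') (h : Climb p C' a b) : Climb p C a b := by
  induction h with
  | refl => exact .refl _
  | step h0 h1 _ ih => exact .step h0 (fun h => h1 (hC h)) ih

theorem Climb.le {a b : ℕ} (hp : ∀ x, 0 < x → p x < x) (h : Climb p C a b) : b ≤ a := by
  induction h with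
  | refl => exact le_rfl
  | step h0 _ _ ih => exact ih.trans (hp _ h0).le

theorem Climb.eq_or {a b : ℕ} (h : Climb p C a b) :
    a = b ∨ (0 < a ∧ a ∉ C ∧ Climb p C (p a) b) := by
  cases h with
  | refl => exact Or.inl rfl
  | step h0 h1 h2 => exact Or.inr ⟨h0, h1, h2⟩

theorem ClimbLast.climb {z a c : ℕ} (h : ClimbLast p C z a c) : Climb p C a z := by
  induction h with
  | base h0 h1 h2 => exact .step h0 h1 (h2 ▸ .refl _)
  | step h0 h1 _ ih => exact .step h0 h1 ih

theorem ClimbLast.lt {z a c : ℕ} (hp : ∀ x, 0 < x → p x < x) (h : ClimbLast p C z a c) :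
    z < a := by
  induction h with
  | base h0 h1 h2 => exact h2 ▸ hp _ h0
  | step h0 h1 _ ih => exact ih.trans (hp _ h0)

theorem ClimbLast.parent_eq {z a c : ℕ} (h : ClimbLast p C z a c) : p c = z := by
  induction h with
  | base h0 h1 h2 => exact h2
  | step h0 h1 _ ih => exact ih

/-- The constructors add links at the bottom, whereas the program climbs by adding them at the top.
One more step replaces the last link. -/
theorem ClimbLast.extend {u a c : ℕ} (h : ClimbLast p C u a c) (hu : 0 < u) (huC : u ∉ C) :
    ClimbLast p C (p u) a u := by
  induction h with
  | base h0 h1 h2 => subst h2; exact .step h0 h1 (.base hu huC rfl)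
  | step h0 h1 _ ih => exact .step h0 h1 ih

/-- Adding the last edge of a path to the cut separates the start of the path from its end. -/
theorem ClimbLast.not_climb {z a c t : ℕ} (hp : ∀ x, 0 < x → p x < x) (h : ClimbLast p C z a c)
    (hc : c ∈ C') (ht : t ≤ z) : ¬ Climb p C' a t := by
  induction h with
  | base h0 h1 h2 =>
    intro h
    cases h with
    | refl => exact absurd (h2 ▸ hp _ h0) (not_lt.2 ht)
    | step _ h3 _ => exact h3 hc
  | step h0 h1 hl ih =>
    intro h
    cases h with
    | refl => exact absurd ((hl.lt hp).trans (hp _ h0)) (not_lt.2 ht)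
    | step _ _ h4 => exact ih hc h4

/-- A colouring with different values at the two ends changes along some link of the climb. From
there the climb still ends with the same link `c`, so cutting `c` will also detach this link. -/
theorem ClimbLast.exists_ne {γ : Type*} {M : ℕ → γ} {z a c : ℕ} (hp : ∀ x, 0 < x → p x < x)
    (h : ClimbLast p C z a c) (hM : M a ≠ M z) :
    ∃ x ≤ a, 0 < x ∧ ClimbLast p C z x c ∧ M x ≠ M (p x) := by
  induction h with
  | base h0 h1 h2 => exact ⟨_, le_rfl, h0, .base h0 h1 h2, by rwa [h2]⟩
  | @step a c h0 h1 hl ih =>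
    by_cases hMa : M a = M (p a)
    · obtain ⟨x, hx, h⟩ := ih (hMa ▸ hM)
      exact ⟨x, hx.trans (hp _ h0).le, h⟩
    · exact ⟨a, le_rfl, h0, .step h0 h1 hl, hMa⟩

/-- A nonroot node `y ≤ z` has a parent below `z`, so its link cannot be in the cut. -/
theorem climb_zero_of_le_parent {z : ℕ} (hp : ∀ x, 0 < x → p x < x)
    (h : ∀ y ∈ C, y ≠ 0 → z ≤ p y) : Climb p C z 0 := by
  have : ∀ y ≤ z, Climb p C y 0 := by
    intro y
    induction y using Nat.strong_induction_on with
    | _ y ih =>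
      intro hy
      rcases Nat.eq_zero_or_pos y with rfl | h0
      · exact .refl _
      · have := hp y h0
        exact .step h0 (fun hC => by have := h y hC h0.ne'; omega) (ih _ this (by omega))
  exact this z le_rfl

/-! ### The greedy invariant and its charging step -/

/-- What holds while the pairs of conflicting nodes are processed: all edges of the cut lie below
`l`, no two conflicting nodes reach a common node `z ≥ k`, and the cut has at most
twice as many edges as there are bichromatic edges separated from the root, for every colouring that
gives conflicting nodes different colours. -/
structure GreedyInv (γ : Type*) (p : ℕ → ℕ) (N : ℕ) (Conf : ℕ → ℕ → Prop) (l k : ℕ)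
    (C : Finset ℕ) : Prop where
  le_parent : ∀ y ∈ C, y ≠ 0 → l ≤ p y
  separated : ∀ z, k ≤ z → ∀ a b, Conf a b → ¬ (Climb p C a z ∧ Climb p C b z)
  card_le : ∀ M : ℕ → γ, (∀ a b, Conf a b → M a ≠ M b) →
    #(C.erase 0) ≤ 2 * Set.ncard {x | x < N ∧ 0 < x ∧ M x ≠ M (p x) ∧ ¬ Climb p C x 0}

theorem GreedyInv.init (γ : Type*) {N : ℕ} {Conf : ℕ → ℕ → Prop}
    (hp : ∀ x, 0 < x → p x < x) (hN : ∀ a b, Conf a b → a < N) :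
    GreedyInv γ p N Conf N N ∅ where
  le_parent := by simp
  separated z hz a b hab h := absurd (h.1.le hp) (by have := hN a b hab; omega)
  card_le := by simp

/-- The charging argument. The colours of `a` and `b` differ, so one differs from the colour of `l`,
and a bichromatic link `x` lies on that climb. It reached the root before and no longer does, so the
counted set grows by at least one while the cut grows by at most two. If `a` or `b` equals `l`, the
missing last link is replaced by the root `0`, which is not counted. -/
theorem GreedyInv.cut {γ : Type*} {N l k : ℕ} {Conf : ℕ → ℕ → Prop} (hp : ∀ x, 0 < x → p x < x)
    (hN : ∀ a b, Conf a b → a < N ∧ b < N) (hI : GreedyInv γ p N Conf l k C) {a b c d : ℕ}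
    (hab : Conf a b) (ha : (a = l ∧ c = 0) ∨ ClimbLast p C l a c)
    (hb : (b = l ∧ d = 0) ∨ ClimbLast p C l b d) :
    GreedyInv γ p N Conf l k (insert c (insert d C)) := by
  have hsub : C ⊆ insert c (insert d C) := fun x hx => by simp [hx]
  refine ⟨?_, fun z hz a b hab h => hI.separated z hz a b hab ⟨h.1.anti hsub, h.2.anti hsub⟩, ?_⟩
  · intro y hy hy0
    simp only [mem_insert] at hy
    rcases hy with rfl | rfl | hy
    · rcases ha with ⟨_, h⟩ | h
      · exact absurd h hy0
      · exact h.parent_eq.ge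
    · rcases hb with ⟨_, h⟩ | h
      · exact absurd h hy0
      · exact h.parent_eq.ge
    · exact hI.le_parent y hy hy0
  · intro M hM
    have hx : ∃ x, x < N ∧ 0 < x ∧ M x ≠ M (p x) ∧ Climb p C x 0 ∧
        ¬ Climb p (insert c (insert d C)) x 0 := by
      have aux : ∀ a c, a < N →
        ((a = l ∧ c = 0) ∨ ClimbLast p C l a c) → M a ≠ M l →
        ∃ x, x < N ∧ 0 < x ∧ M x ≠ M (p x) ∧ Climb p C x 0 ∧
          ∀ C' : Finset ℕ, c ∈ C' → ¬ Climb p C' x 0 := by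
        rintro a c haN (⟨rfl, _⟩ | h) hne
        · exact absurd rfl hne
        · obtain ⟨x, hxa, hx0, hl, hMx⟩ := h.exists_ne hp hne
          exact ⟨x, by omega, hx0, hMx, hl.climb.trans (climb_zero_of_le_parent hp hI.le_parent),
            fun C' hC' => hl.not_climb hp hC' (Nat.zero_le _)⟩
      by_cases hMa : M a = M l
      · have hMb : M b ≠ M l := fun h => hM a b hab (hMa.trans h.symm)
        obtain ⟨x, h1, h2, h3, h4, h5⟩ := aux b d (hN a b hab).2 hb hMb
        exact ⟨x, h1, h2, h3, h4, h5 _ (by simp)⟩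
      · obtain ⟨x, h1, h2, h3, h4, h5⟩ := aux a c (hN a b hab).1 ha hMa
        exact ⟨x, h1, h2, h3, h4, h5 _ (by simp)⟩
    obtain ⟨x, hxN, hx0, hMx, hcl, hncl⟩ := hx
    have h1 := hI.card_le M hM
    have h2 : #((insert c (insert d C)).erase 0) ≤ #(C.erase 0) + 2 := by
      calc _ ≤ #(insert c (insert d (C.erase 0))) := card_le_card (by
            intro y hy
            simp only [mem_erase, mem_insert] at hy ⊢
            tauto)
        _ ≤ _ := (card_insert_le _ _).trans (Nat.succ_le_succ (card_insert_le _ _))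
    set S := {x | x < N ∧ 0 < x ∧ M x ≠ M (p x) ∧ ¬ Climb p C x 0} with hS
    set S' := {x | x < N ∧ 0 < x ∧ M x ≠ M (p x) ∧ ¬ Climb p (insert c (insert d C)) x 0} with hS'
    have hfin : S'.Finite := (Set.finite_lt_nat N).subset fun y hy => hy.1
    have hxS : x ∉ S := fun h => h.2.2.2 hcl
    have hss : insert x S ⊆ S' := by
      rintro y (rfl | hy)
      · exact ⟨hxN, hx0, hMx, hncl⟩
      · exact ⟨hy.1, hy.2.1, hy.2.2.1, fun h => hy.2.2.2 (h.anti hsub)⟩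
    have h3 := Set.ncard_le_ncard hss hfin
    rw [Set.ncard_insert_of_notMem hxS (hfin.subset ((Set.subset_insert _ _).trans hss))] at h3
    omega

theorem not_climb_of_cut {l : ℕ} (hp : ∀ x, 0 < x → p x < x) {a b c d : ℕ} (hab : a ≠ b)
    (ha : (a = l ∧ c = 0) ∨ ClimbLast p C l a c) (hb : (b = l ∧ d = 0) ∨ ClimbLast p C l b d) :
    ¬ (Climb p (insert c (insert d C)) a l ∧ Climb p (insert c (insert d C)) b l) := by
  rintro ⟨h1, h2⟩
  rcases ha with ⟨rfl, _⟩ | ha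
  · rcases hb with ⟨rfl, _⟩ | hb
    · exact hab rfl
    · exact hb.not_climb hp (by simp) le_rfl h2
  · exact ha.not_climb hp (by simp) le_rfl h1

end TreeMulticut

/-! ### Decompositions of a rooted tree -/

namespace TreeDrawing

open SimpleGraph Finset TreeMulticut

/-- A numbering `y 0, …, y m` of the vertices of `G` such that the edges of `G` join the vertices
`y (k + 1)` to their parents `y (q k)`, `q k ≤ k`. The subdivision of `G`, rooted at `y 0`, has the
nodes `2 * j` for the vertices `y j` and `2 * k + 1` for the edges `y (q k) y (k + 1)`; the parent
of the node `x` in it is `p x`. -/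
structure IsRooting {V : Type*} (G : SimpleGraph V) (m : ℕ) (y : ℕ → V) (q p : ℕ → ℕ) : Prop where
  q_le : ∀ k < m, q k ≤ k
  inj : ∀ i ≤ m, ∀ j ≤ m, y i = y j → i = j
  surj : ∀ v, ∃ i ≤ m, y i = v
  edge_mem : ∀ k < m, s(y (q k), y (k + 1)) ∈ G.edgeSet
  edge_surj : ∀ e ∈ G.edgeSet, ∃ k < m, s(y (q k), y (k + 1)) = e
  p_vertex : ∀ k < m, p (2 * k + 2) = 2 * k + 1
  p_edge : ∀ k < m, p (2 * k + 1) = 2 * q k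

section Rooting

variable {V : Type*} {G : SimpleGraph V} {m : ℕ} {y : ℕ → V} {q p : ℕ → ℕ}

/-- The end with the larger number is `k + 1`, so it determines the edge. -/
theorem parent_edge_inj (hq : ∀ k < m, q k ≤ k) (hy : ∀ i ≤ m, ∀ j ≤ m, y i = y j → i = j)
    {k l : ℕ} (hk : k < m) (hl : l < m)
    (h : s(y (q k), y (k + 1)) = s(y (q l), y (l + 1))) : k = l := by
  have h1 := hq k hk
  have h2 := hq l hl
  rcases Sym2.eq_iff.1 h with ⟨_, h⟩ | ⟨h, h'⟩
  · have := hy _ (by omega) _ (by omega) h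
    omega
  · have := hy _ (by omega) _ (by omega) h
    have := hy _ (by omega) _ (by omega) h'
    omega

theorem IsRooting.edge_inj (hR : IsRooting G m y q p) {k l : ℕ} (hk : k < m) (hl : l < m)
    (h : s(y (q k), y (k + 1)) = s(y (q l), y (l + 1))) : k = l :=
  parent_edge_inj hR.q_le hR.inj hk hl h

/-- Two edges of a rooted tree whose nodes in the subdivision are `a` and `b` are in conflict. -/
def EdgeConflict (pos : V → Plane) (m : ℕ) (y : ℕ → V) (q : ℕ → ℕ) (a b : ℕ) : Prop :=
  ∃ i < m, ∃ j < m, a = 2 * i + 1 ∧ b = 2 * j + 1 ∧ i ≠ j ∧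
    ¬ SameSide (pos (y (q i))) (pos (y (i + 1))) (pos (y (q j))) (pos (y (j + 1)))

/-- `lab x` is the topmost node that can be reached from `x` without using an edge of `C`. -/
structure IsLabelling (p : ℕ → ℕ) (C : Finset ℕ) (N : ℕ) (lab : ℕ → ℕ) : Prop where
  zero : lab 0 = 0
  of_mem : ∀ x < N, x ∈ C → lab x = x
  of_notMem : ∀ x < N, 0 < x → x ∉ C → lab x = lab (p x)

variable {C : Finset ℕ} {N : ℕ} {lab : ℕ → ℕ}

theorem IsLabelling.climb (h : IsLabelling p C N lab) (hp : ∀ x, 0 < x → p x < x) :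
    ∀ x < N, Climb p C x (lab x) ∧ (lab x = 0 ∨ lab x ∈ C.erase 0) := by
  intro x
  induction x using Nat.strong_induction_on with
  | _ x ih =>
    intro hx
    rcases Nat.eq_zero_or_pos x with rfl | h0
    · rw [h.zero]
      exact ⟨.refl _, Or.inl rfl⟩
    by_cases hxC : x ∈ C
    · rw [h.of_mem x hx hxC]
      exact ⟨.refl _, Or.inr (mem_erase.2 ⟨h0.ne', hxC⟩)⟩
    · rw [h.of_notMem x hx h0 hxC]
      have := ih (p x) (hp x h0) ((hp x h0).trans hx)
      exact ⟨.step h0 hxC this.1, this.2⟩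

theorem IsLabelling.le (h : IsLabelling p C N lab) (hp : ∀ x, 0 < x → p x < x) {x : ℕ}
    (hx : x < N) : lab x ≤ x := (h.climb hp x hx).1.le hp

end Rooting

/-! ### The fibres of a labelling -/

section Fibres

variable {V : Type*} {G : SimpleGraph V} [Fintype G.edgeSet]

theorem fromEdgeSet_adj_iff {F : Finset (Sym2 V)} (hF : F ⊆ G.edgeFinset) {a b : V} :
    (fromEdgeSet (F : Set (Sym2 V))).Adj a b ↔ s(a, b) ∈ F := by
  rw [fromEdgeSet_adj, mem_coe]
  exact and_iff_left_of_imp fun h => (mem_edgeFinset.1 (hF h) : G.Adj a b).ne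

/-- Every inner vertex of a walk is incident to an edge of it, so the walk never leaves the support.
-/
theorem reachable_induce_support {H : SimpleGraph V} {a b : V} (w : H.Walk a b)
    (ha : a ∈ H.support) (hb : b ∈ H.support) :
    (H.induce H.support).Reachable ⟨a, ha⟩ ⟨b, hb⟩ := by
  induction w with
  | nil => exact Reachable.refl _
  | @cons a c b h w ih =>
    have hc : c ∈ H.support := ⟨a, h.symm⟩
    have : (H.induce H.support).Adj ⟨a, ha⟩ ⟨c, hc⟩ := h
    exact this.reachable.trans (ih hc hb)

variable {m : ℕ} {y : ℕ → V} {q p : ℕ → ℕ} {C : Finset ℕ}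
  {lab : ℕ → ℕ} {ℓ : Sym2 V → ℕ}

/-- The partition of a finite set into the fibres of a function. -/
def fibrePartition [DecidableEq V] (E : Finset (Sym2 V)) (ℓ : Sym2 V → ℕ) : Finpartition E :=
  Finpartition.ofExistsUnique (E.image fun e => E.filter fun f => ℓ f = ℓ e)
    (by simp [filter_subset])
    (by
      intro a ha
      refine ⟨E.filter fun f => ℓ f = ℓ a, ⟨mem_image_of_mem _ ha, by simp [ha]⟩, ?_⟩
      rintro F ⟨hF, haF⟩
      obtain ⟨e, he, rfl⟩ := mem_image.1 hF
      rw [(mem_filter.1 haF).2])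
    (by
      intro h
      obtain ⟨e, he, h⟩ := mem_image.1 h
      have : e ∈ E.filter fun f => ℓ f = ℓ e := by simp [he]
      simp [h] at this)

theorem mem_fibrePartition_parts [DecidableEq V] {E F : Finset (Sym2 V)} {ℓ : Sym2 V → ℕ} :
    F ∈ (fibrePartition E ℓ).parts ↔ ∃ e ∈ E, (E.filter fun f => ℓ f = ℓ e) = F := by
  exact mem_image

theorem exists_mem_fibrePartition_iff [DecidableEq V] {E : Finset (Sym2 V)} {ℓ : Sym2 V → ℕ}
    {e f : Sym2 V} (he : e ∈ E) (hf : f ∈ E) :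
    (∃ F ∈ (fibrePartition E ℓ).parts, e ∈ F ∧ f ∈ F) ↔ ℓ e = ℓ f := by
  constructor
  · rintro ⟨F, hF, heF, hfF⟩
    obtain ⟨g, hg, rfl⟩ := mem_fibrePartition_parts.1 hF
    exact (mem_filter.1 heF).2.trans (mem_filter.1 hfF).2.symm
  · intro h
    exact ⟨_, mem_fibrePartition_parts.2 ⟨f, hf, rfl⟩, by simp [he, h], by simp [hf]⟩

/-- The only possible labels are the root and the nonroot nodes of the cut. -/
theorem card_fibrePartition_le [DecidableEq V] (hR : IsRooting G m y q p)
    (hp : ∀ x, 0 < x → p x < x)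
    (hlab : IsLabelling p C (2 * m + 1) lab)
    (hℓ : ∀ k < m, ℓ s(y (q k), y (k + 1)) = lab (2 * k + 1)) :
    #(fibrePartition G.edgeFinset ℓ).parts ≤ #(C.erase 0) + 1 := by
  calc _ ≤ #((insert 0 (C.erase 0)).image fun t => G.edgeFinset.filter fun f => ℓ f = t) := by
        apply card_le_card
        intro F hF
        obtain ⟨e, he, rfl⟩ := mem_fibrePartition_parts.1 hF
        refine mem_image.2 ⟨ℓ e, ?_, rfl⟩
        obtain ⟨k, hk, rfl⟩ := hR.edge_surj e (mem_edgeFinset.1 he)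
        rw [hℓ k hk, mem_insert]
        exact (hlab.climb hp _ (by omega)).2
    _ ≤ _ := card_image_le.trans (card_insert_le _ _)

/-- A subgraph of a tree has no cycles. It is connected because every edge of the fibre leads,
through edges of the fibre, to one vertex determined by the common label. -/
theorem isTree_partGraph_fibre (hG : G.IsTree) (hR : IsRooting G m y q p)
    (hlab : IsLabelling p C (2 * m + 1) lab)
    (hℓ : ∀ k < m, ℓ s(y (q k), y (k + 1)) = lab (2 * k + 1)) {e : Sym2 V}
    (he : e ∈ G.edgeFinset) :
    (partGraph (G.edgeFinset.filter fun f => ℓ f = ℓ e)).IsTree := by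
  set F := G.edgeFinset.filter fun f => ℓ f = ℓ e with hF
  have hFG : F ⊆ G.edgeFinset := filter_subset _ _
  have hle : fromEdgeSet (F : Set (Sym2 V)) ≤ G := by
    intro a b hab
    exact mem_edgeFinset.1 (hFG ((fromEdgeSet_adj_iff hFG).1 hab))
  have hmem : ∀ k < m, lab (2 * k + 1) = ℓ e → s(y (q k), y (k + 1)) ∈ F := fun k hk h =>
    mem_filter.2 ⟨mem_edgeFinset.2 (hR.edge_mem k hk), (hℓ k hk).trans h⟩
  -- If the topmost node stands for an edge, its link to the upper end is cut, but the edge still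
  -- contains that end; this is then the top vertex.
  let top : V := if ℓ e % 2 = 0 then y (ℓ e / 2) else y (q (ℓ e / 2))
  have hreach : ∀ k < m, lab (2 * k + 1) = ℓ e →
      (fromEdgeSet (F : Set (Sym2 V))).Reachable (y (q k)) top := by
    intro k
    induction k using Nat.strong_induction_on with
    | _ k ih =>
      intro hk hlk
      by_cases hkC : 2 * k + 1 ∈ C
      · have h1 := hlab.of_mem _ (by omega) hkC
        have : top = y (q k) := by
          simp only [top]
          rw [if_neg (by omega), show ℓ e / 2 = k by omega]
        rw [this]
      · have h1 := hlab.of_notMem _ (by omega) (by omega) hkC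
        rw [hR.p_edge k hk] at h1
        have hqk := hR.q_le k hk
        by_cases hend : q k = 0 ∨ 2 * q k ∈ C
        · have h2 : lab (2 * q k) = 2 * q k := by
            rcases hend with h | h
            · rw [h]; exact hlab.zero
            · exact hlab.of_mem _ (by omega) h
          have : top = y (q k) := by
            simp only [top]
            rw [if_pos (by omega), show ℓ e / 2 = q k by omega]
          rw [this]
        · push Not at hend
          obtain ⟨i, hi⟩ := Nat.exists_eq_succ_of_ne_zero hend.1
          have h2 := hlab.of_notMem _ (by omega) (by omega) hend.2
          rw [hi, show 2 * i.succ = 2 * i + 2 by omega, hR.p_vertex i (by omega)] at h2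
          have h3 : lab (2 * i + 1) = ℓ e := by
            rw [← h2, ← hlk, h1, hi]
            congr 1
          have h4 := ih i (by omega) (by omega) h3
          have h5 := (fromEdgeSet_adj_iff hFG).2 (hmem i (by omega) h3)
          rw [hi]
          exact h5.symm.reachable.trans h4
  have htop : ∀ v ∈ (fromEdgeSet (F : Set (Sym2 V))).support,
      (fromEdgeSet (F : Set (Sym2 V))).Reachable v top := by
    rintro v ⟨w, hvw⟩
    have h1 := (fromEdgeSet_adj_iff hFG).1 hvw
    obtain ⟨k, hk, hke⟩ := hR.edge_surj _ (mem_edgeFinset.1 (hFG h1))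
    have hlk : lab (2 * k + 1) = ℓ e := by
      rw [← hℓ k hk, hke]
      exact (mem_filter.1 h1).2
    have h2 := hreach k hk hlk
    rcases Sym2.eq_iff.1 hke with ⟨rfl, rfl⟩ | ⟨rfl, rfl⟩
    · exact h2
    · exact hvw.reachable.trans h2
  refine ⟨?_, (hG.isAcyclic.anti hle).induce _⟩
  have hne : Nonempty (partVerts F) := by
    induction e with
    | _ a b =>
      exact ⟨⟨a, b, (fromEdgeSet_adj_iff hFG).2 (mem_filter.2 ⟨he, rfl⟩)⟩⟩
  refine ⟨fun a b => ?_⟩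
  obtain ⟨w⟩ := (htop a a.2).trans (htop b b.2).symm
  exact reachable_induce_support w a.2 b.2

theorem isIncreasingChordSubtree_fibre {pos : V → Plane} (hpos : Function.Injective pos)
    (hG : G.IsTree) (hR : IsRooting G m y q p) (hlab : IsLabelling p C (2 * m + 1) lab)
    (hℓ : ∀ k < m, ℓ s(y (q k), y (k + 1)) = lab (2 * k + 1))
    (hC : ∀ a b, EdgeConflict pos m y q a b → lab a ≠ lab b) {e : Sym2 V}
    (he : e ∈ G.edgeFinset) :
    IsIncreasingChordSubtree pos (G.edgeFinset.filter fun f => ℓ f = ℓ e) := by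
  have htree := isTree_partGraph_fibre hG hR hlab hℓ he
  refine ⟨htree, isIncreasingChordDrawing_of_sameSide (hpos.comp Subtype.val_injective)
    htree.connected ?_⟩
  rintro ⟨a, ha⟩ ⟨b, hb⟩ ⟨c, hc⟩ ⟨d, hd⟩ hab hcd hne
  have hFG : (G.edgeFinset.filter fun f => ℓ f = ℓ e) ⊆ G.edgeFinset := filter_subset _ _
  have h1 : s(a, b) ∈ _ := (fromEdgeSet_adj_iff hFG).1 hab
  have h2 : s(c, d) ∈ _ := (fromEdgeSet_adj_iff hFG).1 hcd
  have hne' : s(a, b) ≠ s(c, d) := by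
    intro h
    apply hne
    rcases Sym2.eq_iff.1 h with ⟨rfl, rfl⟩ | ⟨rfl, rfl⟩
    · rfl
    · exact Sym2.eq_swap
  obtain ⟨i, hi, hie⟩ := hR.edge_surj _ (mem_edgeFinset.1 (hFG h1))
  obtain ⟨j, hj, hje⟩ := hR.edge_surj _ (mem_edgeFinset.1 (hFG h2))
  have hij : i ≠ j := by
    rintro rfl
    exact hne' (hie.symm.trans hje)
  have hS : SameSide (pos (y (q i))) (pos (y (i + 1))) (pos (y (q j))) (pos (y (j + 1))) := by
    by_contra hS
    refine hC _ _ ⟨i, hi, j, hj, rfl, rfl, hij, hS⟩ ?_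
    rw [← hℓ i hi, ← hℓ j hj, hie, hje]
    exact (mem_filter.1 h1).2.trans (mem_filter.1 h2).2.symm
  show SameSide (pos a) (pos b) (pos c) (pos d)
  rcases Sym2.eq_iff.1 hie with ⟨rfl, rfl⟩ | ⟨rfl, rfl⟩ <;>
  rcases Sym2.eq_iff.1 hje with ⟨rfl, rfl⟩ | ⟨rfl, rfl⟩
  · exact hS
  · exact hS.swap_right
  · exact hS.swap_left
  · exact hS.swap_left.swap_right

/-- A vertex is a leaf of every fibre but the one to which it belongs itself. -/
theorem isLeafOf_fibre (hR : IsRooting G m y q p) (hp : ∀ x, 0 < x → p x < x)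
    (hlab : IsLabelling p C (2 * m + 1) lab)
    (hℓ : ∀ k < m, ℓ s(y (q k), y (k + 1)) = lab (2 * k + 1)) {t z : ℕ} (hz : z ≤ m)
    (ht : t ≠ lab (2 * z)) (hv : y z ∈ partVerts (G.edgeFinset.filter fun f => ℓ f = t)) :
    IsLeafOf (G.edgeFinset.filter fun f => ℓ f = t) (y z) := by
  have hFG : (G.edgeFinset.filter fun f => ℓ f = t) ⊆ G.edgeFinset := filter_subset _ _
  -- As `t` is not the label of `y z`, an edge of the fibre leading down from `y z` must be cut off
  -- there and has its own node as label. The edge leading up has a label smaller than any of these,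
  -- so the two kinds exclude each other and `t` determines the edge.
  have key : ∀ w, s(y z, w) ∈ (G.edgeFinset.filter fun f => ℓ f = t) → ∃ k < m,
      s(y (q k), y (k + 1)) = s(y z, w) ∧ ((q k = z ∧ t = 2 * k + 1) ∨
        (k + 1 = z ∧ t ≤ 2 * k + 1)) := by
    intro w hw
    obtain ⟨k, hk, hke⟩ := hR.edge_surj _ (mem_edgeFinset.1 (hFG hw))
    have hlk : lab (2 * k + 1) = t := by
      rw [← hℓ k hk, hke]
      exact (mem_filter.1 hw).2
    have hqk := hR.q_le k hk
    refine ⟨k, hk, hke, ?_⟩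
    rcases Sym2.eq_iff.1 hke with ⟨h, _⟩ | ⟨_, h⟩
    · left
      have hqz := hR.inj _ (by omega) _ hz h
      refine ⟨hqz, ?_⟩
      by_cases hkC : 2 * k + 1 ∈ C
      · rw [← hlk, hlab.of_mem _ (by omega) hkC]
      · have h1 := hlab.of_notMem _ (by omega) (by omega) hkC
        rw [hR.p_edge k hk, hqz] at h1
        exact absurd (hlk.symm.trans h1) ht
    · right
      refine ⟨hR.inj _ (by omega) _ hz h, ?_⟩
      rw [← hlk]
      exact hlab.le hp (by omega)
  obtain ⟨w₀, hw₀⟩ := hv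
  rw [IsLeafOf, Set.ncard_eq_one]
  refine ⟨w₀, Set.eq_singleton_iff_unique_mem.2 ⟨hw₀, fun w hw => ?_⟩⟩
  obtain ⟨k, hk, hke, h⟩ := key w ((fromEdgeSet_adj_iff hFG).1 hw)
  obtain ⟨k₀, hk₀, hke₀, h₀⟩ := key w₀ ((fromEdgeSet_adj_iff hFG).1 hw₀)
  have h1 := hR.q_le k hk
  have h2 := hR.q_le k₀ hk₀
  have : k = k₀ := by omega
  subst this
  exact Sym2.congr_right.1 (hke.symm.trans hke₀)

/-- At most one of two different fibres has the label of a given vertex node; in the other one the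
vertex is a leaf. -/
theorem isProperDecomposition_fibrePartition [DecidableEq V] {pos : V → Plane}
    (hpos : Function.Injective pos)
    (hG : G.IsTree) (hR : IsRooting G m y q p) (hp : ∀ x, 0 < x → p x < x)
    (hlab : IsLabelling p C (2 * m + 1) lab)
    (hℓ : ∀ k < m, ℓ s(y (q k), y (k + 1)) = lab (2 * k + 1))
    (hC : ∀ a b, EdgeConflict pos m y q a b → lab a ≠ lab b) :
    IsProperDecomposition pos (fibrePartition G.edgeFinset ℓ) := by
  constructor
  · intro F hF
    obtain ⟨e, he, rfl⟩ := mem_fibrePartition_parts.1 hF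
    exact isIncreasingChordSubtree_fibre hpos hG hR hlab hℓ hC he
  · intro F₁ hF₁ F₂ hF₂ hne v hv₁ hv₂
    obtain ⟨e, he, rfl⟩ := mem_fibrePartition_parts.1 hF₁
    obtain ⟨f, hf, rfl⟩ := mem_fibrePartition_parts.1 hF₂
    obtain ⟨z, hz, rfl⟩ := hR.surj v
    by_cases h : ℓ e = lab (2 * z)
    · refine Or.inr (isLeafOf_fibre hR hp hlab hℓ hz (fun h' => hne ?_) hv₂)
      rw [h, h']
    · exact Or.inl (isLeafOf_fibre hR hp hlab hℓ hz h hv₁)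

end Fibres

/-! ### The lower bound -/

section LowerBound

variable {V : Type*} [Fintype V] [DecidableEq V] {G : SimpleGraph V} [Fintype G.edgeSet]
  {m : ℕ} {y : ℕ → V} {q p : ℕ → ℕ} {pos : V → Plane} {P : Finpartition G.edgeFinset}

theorem ncard_partVerts {F : Finset (Sym2 V)} (hF : F ⊆ G.edgeFinset)
    (hT : (partGraph F).IsTree) : (partVerts F).ncard = #F + 1 := by
  classical
  have h1 := hT.card_edgeFinset
  have h2 : (fromEdgeSet (F : Set (Sym2 V))).edgeFinset = F := by
    ext e
    induction e with
    | _ a b => rw [mem_edgeFinset, mem_edgeSet, fromEdgeSet_adj_iff hF]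
  have h3 : #(partGraph F).edgeFinset = #F :=
    (by convert card_edgeFinset_induce_support : _ = _).trans (congrArg card h2)
  rw [← Nat.card_coe_set_eq, Nat.card_eq_fintype_card, ← h1, h3]

/-- Each part is a tree with one more vertex than edges, and the parts together have `n - 1` edges.
-/
theorem sum_ncard_partVerts (hG : G.IsTree) (hP : IsProperDecomposition pos P) :
    ∑ F ∈ P.parts, (partVerts F).ncard + 1 = Fintype.card V + #P.parts := by
  rw [sum_congr rfl fun F hF => ncard_partVerts (P.le hF) (hP.1 F hF).1, sum_add_distrib,
    P.sum_card_parts, sum_const, smul_eq_mul, mul_one, ← hG.card_edgeFinset]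
  ring

/-- Every vertex lies in some part such that it is a leaf of all other parts containing it. -/
theorem exists_main_part [Nontrivial V] (hG : G.IsTree) (hP : IsProperDecomposition pos P)
    (v : V) : ∃ F ∈ P.parts, v ∈ partVerts F ∧
      ∀ F' ∈ P.parts, v ∈ partVerts F' → F' ≠ F → IsLeafOf F' v := by
  by_cases h : ∃ F ∈ P.parts, v ∈ partVerts F ∧ ¬ IsLeafOf F v
  · obtain ⟨F, hF, hv, hl⟩ := h
    exact ⟨F, hF, hv, fun F' hF' hv' hne =>
      (hP.2 F' hF' F hF hne v hv' hv).resolve_right hl⟩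
  · push Not at h
    obtain ⟨w, hvw⟩ := hG.connected.preconnected.exists_adj_of_nontrivial v
    obtain ⟨F, hF, he⟩ := P.exists_mem (mem_edgeFinset.2 (mem_edgeSet G |>.2 hvw))
    exact ⟨F, hF, ⟨w, (fromEdgeSet_adj_iff (P.le hF)).2 he⟩, fun F' hF' hv' _ => h F' hF' hv'⟩

/-- A decomposition with proper contacts colours the subdivided tree in such a way that
edges in different parts get different colours and that there are fewer bichromatic edges than
parts. -/
theorem exists_colouring [Nontrivial V] (hG : G.IsTree) (hR : IsRooting G m y q p)
    (hP : IsProperDecomposition pos P) : ∃ M : ℕ → Finset (Sym2 V),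
      (∀ a b, EdgeConflict pos m y q a b → M a ≠ M b) ∧
      Set.ncard {x | x < 2 * m + 1 ∧ 0 < x ∧ M x ≠ M (p x)} + 1 ≤ #P.parts := by
  classical
  choose main hmain hmem hleaf using exists_main_part hG hP
  set edge : ℕ → Sym2 V := fun k => s(y (q k), y (k + 1)) with hedge
  have hedgeE : ∀ k < m, edge k ∈ G.edgeFinset := fun k hk => mem_edgeFinset.2 (hR.edge_mem k hk)
  have hpart : ∀ k < m, P.part (edge k) ∈ P.parts := fun k hk => P.part_mem.2 (hedgeE k hk)
  have hself : ∀ k < m, edge k ∈ P.part (edge k) := fun k hk => P.mem_part (hedgeE k hk)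
  -- An edge node gets the part of its edge, a vertex node its main part. Links change colour only
  -- where an edge belongs to a part that is not the main one of its end.
  let M : ℕ → Finset (Sym2 V) := fun x =>
    if x % 2 = 0 then main (y (x / 2)) else P.part (edge (x / 2))
  have hMv : ∀ j, M (2 * j) = main (y j) := fun j => by simp [M]
  have hMe : ∀ k, M (2 * k + 1) = P.part (edge k) := fun k => by
    simp only [M]
    rw [if_neg (by omega), show (2 * k + 1) / 2 = k by omega]
  refine ⟨M, ?_, ?_⟩
  · rintro a b ⟨i, hi, j, hj, rfl, rfl, hij, hS⟩ hM
    rw [hMe, hMe] at hM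
    apply hS
    have hF := hpart i hi
    have hFG := P.le hF
    obtain ⟨hT, hI⟩ := hP.1 _ hF
    have hai := (fromEdgeSet_adj_iff hFG).2 (hself i hi)
    have haj := (fromEdgeSet_adj_iff hFG).2 (hM ▸ hself j hj)
    have hne : edge i ≠ edge j := fun h => hij (hR.edge_inj hi hj h)
    have := sameSide_of_isIncreasingChordDrawing hT hI (u := ⟨y (q i), _, hai⟩)
      (v := ⟨y (i + 1), _, hai.symm⟩) (x := ⟨y (q j), _, haj⟩) (y := ⟨y (j + 1), _, haj.symm⟩)
      hai haj (by
        intro h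
        apply hne
        have := congrArg (Sym2.map Subtype.val) h
        rwa [Sym2.map_mk, Sym2.map_mk] at this)
    exact this
  · set B : Finset (V × Finset (Sym2 V)) :=
      (univ ×ˢ P.parts).filter fun x => x.1 ∈ partVerts x.2 with hB
    set B' := B.filter fun x => x.2 ≠ main x.1 with hB'
    have hcardB : #B + 1 = Fintype.card V + #P.parts := by
      rw [← sum_ncard_partVerts hG hP, hB, card_filter, sum_product_right]
      congr 1
      refine sum_congr rfl fun F hF => ?_
      rw [← card_filter, ← Set.ncard_coe_finset]
      congr 1
      ext v
      simp
    have hcardB' : #B' + Fintype.card V = #B := by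
      rw [hB', ← card_filter_add_card_filter_not (s := B) (fun x => x.2 ≠ main x.1)]
      congr 1
      rw [← card_univ, ← card_image_of_injective univ
        (f := fun v => (v, main v)) (fun a b h => (Prod.ext_iff.1 h).1)]
      congr 1
      ext ⟨v, F⟩
      simp only [mem_image, mem_univ, true_and, Prod.mk.injEq, mem_filter, not_not, hB,
        mem_product]
      constructor
      · rintro ⟨_, rfl, rfl⟩
        exact ⟨⟨hmain _, hmem _⟩, rfl⟩
      · rintro ⟨_, h⟩
        exact ⟨v, rfl, h.symm⟩
    have hle : Set.ncard {x | x < 2 * m + 1 ∧ 0 < x ∧ M x ≠ M (p x)} ≤ #B' := by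
      rw [← Set.ncard_coe_finset]
      -- A link of the subdivided tree is a pair of a vertex and an incident edge; the map replaces
      -- the edge by its part. It is injective on bichromatic links because a vertex is a leaf of
      -- its other parts.
      let φ : ℕ → V × Finset (Sym2 V) := fun x =>
        (if x % 2 = 0 then y (x / 2) else y (q (x / 2)), P.part (edge ((x - 1) / 2)))
      have spec : ∀ x, x < 2 * m + 1 → 0 < x → M x ≠ M (p x) → ∃ k < m,
          (φ x).2 = P.part (edge k) ∧ (φ x).2 ≠ main (φ x).1 ∧
            ((x = 2 * k + 1 ∧ (φ x).1 = y (q k)) ∨ (x = 2 * k + 2 ∧ (φ x).1 = y (k + 1))) := by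
        intro x hx h0 hM
        rcases Nat.even_or_odd' x with ⟨j, rfl | rfl⟩
        · obtain ⟨k, rfl⟩ := Nat.exists_eq_succ_of_ne_zero (show j ≠ 0 by omega)
          have hk : k < m := by omega
          rw [hMv, show 2 * k.succ = 2 * k + 2 by omega, hR.p_vertex k hk, hMe] at hM
          have h1 : φ (2 * k.succ) = (y (k + 1), P.part (edge k)) := by
            simp only [φ]
            rw [if_pos (by omega), show (2 * k.succ) / 2 = k + 1 by omega,
              show (2 * k.succ - 1) / 2 = k by omega]
          rw [h1]
          exact ⟨k, hk, rfl, hM.symm, Or.inr ⟨by omega, rfl⟩⟩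
        · have hk : j < m := by omega
          rw [hMe, hR.p_edge j hk, hMv] at hM
          have h1 : φ (2 * j + 1) = (y (q j), P.part (edge j)) := by
            simp only [φ]
            rw [if_neg (by omega), show (2 * j + 1) / 2 = j by omega,
              show (2 * j + 1 - 1) / 2 = j by omega]
          rw [h1]
          exact ⟨j, hk, rfl, hM, Or.inl ⟨rfl, rfl⟩⟩
      have hinc : ∀ x k, k < m → (φ x).2 = P.part (edge k) →
          ((φ x).1 = y (q k) ∨ (φ x).1 = y (k + 1)) →
          ∃ w, s((φ x).1, w) = edge k ∧
            (fromEdgeSet ((P.part (edge k) : Finset _) : Set (Sym2 V))).Adj (φ x).1 w := by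
        intro x k hk h1 h2
        have hadj := (fromEdgeSet_adj_iff (P.le (hpart k hk))).2 (hself k hk)
        rcases h2 with h2 | h2 <;> rw [h2]
        · exact ⟨_, rfl, hadj⟩
        · exact ⟨_, Sym2.eq_swap, hadj.symm⟩
      refine Set.ncard_le_ncard_of_injOn φ ?_ ?_ (finite_toSet _)
      · rintro x ⟨hx, h0, hM⟩
        obtain ⟨k, hk, h1, h2, h3⟩ := spec x hx h0 hM
        obtain ⟨w, _, hw⟩ := hinc x k hk h1 (h3.imp And.right And.right)
        rw [mem_coe, hB', mem_filter, hB, mem_filter, mem_product]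
        refine ⟨⟨⟨mem_univ _, ?_⟩, ?_⟩, h2⟩
        · rw [h1]; exact hpart k hk
        · rw [h1]; exact ⟨w, hw⟩
      · rintro x ⟨hx, h0, hM⟩ x' ⟨hx', h0', hM'⟩ hφ
        obtain ⟨k, hk, h1, h2, h3⟩ := spec x hx h0 hM
        obtain ⟨k', hk', h1', h2', h3'⟩ := spec x' hx' h0' hM'
        obtain ⟨w, hwe, hw⟩ := hinc x k hk h1 (h3.imp And.right And.right)
        obtain ⟨w', hwe', hw'⟩ := hinc x' k' hk' h1' (h3'.imp And.right And.right)
        have hl := hleaf (φ x).1 _ (h1 ▸ hpart k hk) (by rw [h1]; exact ⟨w, hw⟩) h2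
        rw [IsLeafOf, Set.ncard_eq_one, h1] at hl
        obtain ⟨w₀, hw₀⟩ := hl
        have e1 : w = w₀ := by
          rw [← Set.mem_singleton_iff, ← hw₀]; exact hw
        have e2 : w' = w₀ := by
          rw [← Set.mem_singleton_iff, ← hw₀, ← h1, hφ, h1']; exact hw'
        have hkk : k = k' := by
          refine hR.edge_inj hk hk' ?_
          show edge k = edge k'
          rw [← hwe, ← hwe', e1, e2, hφ]
        subst hkk
        have hq := hR.q_le k hk
        rcases h3 with ⟨h, h3⟩ | ⟨h, h3⟩ <;> rcases h3' with ⟨h', h3'⟩ | ⟨h', h3'⟩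
        · omega
        · rw [← hφ, h3] at h3'
          have := hR.inj _ (by omega) _ (by omega) h3'
          omega
        · rw [← hφ, h3] at h3'
          have := hR.inj _ (by omega) _ (by omega) h3'
          omega
        · omega
    omega

end LowerBound

/-! ### The approximation ratio -/

/-- The fibres of the labelling given by a greedily computed cut form a decomposition with proper
contacts that has fewer than twice as many parts as an optimal one. -/
theorem greedy_approximation {V : Type*} [Fintype V] [DecidableEq V] [Nontrivial V]
    {G : SimpleGraph V} [Fintype G.edgeSet] {m : ℕ} {y : ℕ → V} {q p : ℕ → ℕ} {C : Finset ℕ}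
    {lab : ℕ → ℕ} {ℓ : Sym2 V → ℕ} {pos : V → Plane} (hpos : Function.Injective pos)
    (hG : G.IsTree) (hR : IsRooting G m y q p) (hp : ∀ x, 0 < x → p x < x)
    (hlab : IsLabelling p C (2 * m + 1) lab)
    (hℓ : ∀ k < m, ℓ s(y (q k), y (k + 1)) = lab (2 * k + 1))
    (hC : GreedyInv (Finset (Sym2 V)) p (2 * m + 1) (EdgeConflict pos m y q) 0 0 C) :
    IsProperDecomposition pos (fibrePartition G.edgeFinset ℓ) ∧
      (#(fibrePartition G.edgeFinset ℓ).parts : ℤ) ≤ 2 * (optSize G pos : ℤ) - 1 := by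
  have hproper : IsProperDecomposition pos (fibrePartition G.edgeFinset ℓ) := by
    refine isProperDecomposition_fibrePartition hpos hG hR hp hlab hℓ fun a b hab h => ?_
    -- Each node climbs to its label, so equal labels would be a common node of the two climbs.
    refine hC.separated (lab a) (Nat.zero_le _) a b hab ?_
    obtain ⟨i, hi, j, hj, rfl, rfl, _⟩ := hab
    have h1 := (hlab.climb hp (2 * i + 1) (by omega)).1
    have h2 := (hlab.climb hp (2 * j + 1) (by omega)).1
    exact ⟨h1, h ▸ h2⟩
  refine ⟨hproper, ?_⟩
  have hne : {k : ℕ | ∃ P : Finpartition G.edgeFinset,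
      IsProperDecomposition pos P ∧ #P.parts = k}.Nonempty := ⟨_, _, hproper, rfl⟩
  obtain ⟨P, hP, hcard⟩ := Nat.sInf_mem hne
  obtain ⟨M, hM, hle⟩ := exists_colouring hG hR hP
  have h1 := hC.card_le M hM
  have h2 := card_fibrePartition_le hR hp hlab hℓ
  have h3 : Set.ncard {x | x < 2 * m + 1 ∧ 0 < x ∧ M x ≠ M (p x) ∧ ¬ Climb p C x 0} ≤
      Set.ncard {x | x < 2 * m + 1 ∧ 0 < x ∧ M x ≠ M (p x)} :=
    Set.ncard_le_ncard (fun x hx => ⟨hx.1, hx.2.1, hx.2.2.1⟩)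
      ((Set.finite_lt_nat (2 * m + 1)).subset fun x hx => hx.1)
  have h4 : optSize G pos = #P.parts := hcard.symm
  omega

end TreeDrawing

/-! ### Reasoning about programs -/

namespace RealRAM

/-- Started in `s`, the program `c` halts after at most `T` operations in a state satisfying `Q`. -/
def Runs (c : Cmd) (s : State) (T : ℕ) (Q : State → Prop) : Prop :=
  ∃ t s', Exec c s t s' ∧ t ≤ T ∧ Q s'

theorem Runs.mono {c : Cmd} {s : State} {T T' : ℕ} {Q Q' : State → Prop} (h : Runs c s T Q)
    (hT : T ≤ T') (hQ : ∀ s, Q s → Q' s) : Runs c s T' Q' := by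
  obtain ⟨t, s', h1, h2, h3⟩ := h
  exact ⟨t, s', h1, h2.trans hT, hQ _ h3⟩

theorem Runs.seq {p q : Cmd} {s : State} {T T' : ℕ} {Q R : State → Prop} (hp : Runs p s T R)
    (hq : ∀ s, R s → Runs q s T' Q) : Runs (.seq p q) s (T + T') Q := by
  obtain ⟨t, s', h1, h2, h3⟩ := hp
  obtain ⟨t', s'', h1', h2', h3'⟩ := hq _ h3
  exact ⟨_, _, .seq h1 h1', add_le_add h2 h2', h3'⟩

theorem Runs.ite {b : Test} {p q : Cmd} {s : State} {T T' : ℕ} {Q : State → Prop}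
    (hp : b.Holds s → Runs p s T Q) (hq : ¬ b.Holds s → Runs q s T' Q) :
    Runs (.ite b p q) s (b.cost + (T + T')) Q := by
  by_cases hb : b.Holds s
  · obtain ⟨t, s', h1, h2, h3⟩ := hp hb
    exact ⟨_, _, .ite_true hb h1, by omega, h3⟩
  · obtain ⟨t, s', h1, h2, h3⟩ := hq hb
    exact ⟨_, _, .ite_false hb h1, by omega, h3⟩

/-- The rule for loops: `I k` holds before an iteration if at most `k` iterations are left. -/
theorem Runs.loop {b : Test} {p : Cmd} {T : ℕ} {Q : State → Prop} (I : ℕ → State → Prop)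
    (hstep : ∀ k s, I k s → b.Holds s → ∃ k', k = k' + 1 ∧ Runs p s T (I k'))
    (hexit : ∀ k s, I k s → ¬ b.Holds s → Q s) (k : ℕ) (s : State) (h : I k s) :
    Runs (.loop b p) s (k * (T + b.cost) + b.cost) Q := by
  induction k generalizing s with
  | zero =>
    by_cases hb : b.Holds s
    · obtain ⟨k', hk, _⟩ := hstep 0 s h hb
      omega
    · exact ⟨_, _, .loop_false hb, by omega, hexit _ _ h hb⟩
  | succ k ih =>
    by_cases hb : b.Holds s
    · obtain ⟨k', hk, t, s', h1, h2, h3⟩ := hstep _ s h hb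
      obtain rfl : k = k' := by omega
      obtain ⟨t', s'', h1', h2', h3'⟩ := ih s' h3
      exact ⟨_, _, .loop_true hb h1 h1', by rw [add_mul]; omega, h3'⟩
    · exact ⟨_, _, .loop_false hb, by omega, hexit _ _ h hb⟩

/-! ### Programs without loops -/

/-- The program contains no loop. -/
def Cmd.LoopFree : Cmd → Prop
  | skip => True
  | setVar _ _ => True
  | setNat _ _ _ => True
  | setReal _ _ _ => True
  | seq p q => p.LoopFree ∧ q.LoopFree
  | ite _ p q => p.LoopFree ∧ q.LoopFree
  | loop _ _ => False

/-- A bound for the number of operations of a program without loops. -/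
def Cmd.maxCost : Cmd → ℕ
  | skip => 1
  | setVar _ e => e.cost + 1
  | setNat _ i e => i.cost + e.cost + 1
  | setReal _ i e => i.cost + e.cost + 1
  | seq p q => p.maxCost + q.maxCost
  | ite b p q => b.cost + (p.maxCost + q.maxCost)
  | loop _ _ => 0

open Classical in
/-- The state in which a program without loops halts. -/
noncomputable def Cmd.post : Cmd → State → State
  | skip, s => s
  | setVar x e, s => { s with nvar := Function.update s.nvar x (e.val s) }
  | setNat a i e, s => { s with narr := Function.update s.narr a
                                  (Function.update (s.narr a) (i.val s) (e.val s)) }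
  | setReal a i e, s => { s with rarr := Function.update s.rarr a
                                  (Function.update (s.rarr a) (i.val s) (e.val s)) }
  | seq p q, s => q.post (p.post s)
  | ite b p q, s => if b.Holds s then p.post s else q.post s
  | loop _ _, s => s

theorem Cmd.post_ite_pos {b : Test} {p q : Cmd} {s : State} (h : b.Holds s) :
    (Cmd.ite b p q).post s = p.post s := by rw [Cmd.post, if_pos h]

theorem Cmd.post_ite_neg {b : Test} {p q : Cmd} {s : State} (h : ¬ b.Holds s) :
    (Cmd.ite b p q).post s = q.post s := by rw [Cmd.post, if_neg h]

/-- Reduces straight-line code to a computation of `post`. Adding the costs of both branches makes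
the bound independent of the state. -/
theorem Runs.loopFree {c : Cmd} (hc : c.LoopFree) {s : State} {Q : State → Prop}
    (h : Q (c.post s)) : Runs c s c.maxCost Q := by
  induction c generalizing s Q with
  | skip => exact ⟨_, _, .skip s, le_rfl, h⟩
  | setVar x e => exact ⟨_, _, .setVar s x e, le_rfl, h⟩
  | setNat a i e => exact ⟨_, _, .setNat s a i e, le_rfl, h⟩
  | setReal a i e => exact ⟨_, _, .setReal s a i e, le_rfl, h⟩
  | seq p q ihp ihq =>
    exact (ihp hc.1 (Q := fun s' => s' = p.post s) rfl).seq fun s' hs' =>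
      ihq hc.2 (by rw [hs']; exact h)
  | ite b p q ihp ihq =>
    refine Runs.ite (fun hb => ihp hc.1 ?_) fun hb => ihq hc.2 ?_
    · rwa [Cmd.post_ite_pos hb] at h
    · rwa [Cmd.post_ite_neg hb] at h
  | loop => exact hc.elim

/-! ### Polynomial bounds for running times -/

/-- Bounded by a polynomial. -/
def PolyBounded (f : ℕ → ℕ) : Prop := ∃ p : Polynomial ℕ, ∀ n, f n ≤ p.eval n

theorem PolyBounded.const (c : ℕ) : PolyBounded fun _ => c := ⟨Polynomial.C c, by simp⟩

theorem PolyBounded.id : PolyBounded fun n => n := ⟨Polynomial.X, by simp⟩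

theorem PolyBounded.add {f g : ℕ → ℕ} (hf : PolyBounded f) (hg : PolyBounded g) :
    PolyBounded fun n => f n + g n := by
  obtain ⟨p, hp⟩ := hf
  obtain ⟨q, hq⟩ := hg
  exact ⟨p + q, fun n => by rw [Polynomial.eval_add]; exact add_le_add (hp n) (hq n)⟩

theorem PolyBounded.mul {f g : ℕ → ℕ} (hf : PolyBounded f) (hg : PolyBounded g) :
    PolyBounded fun n => f n * g n := by
  obtain ⟨p, hp⟩ := hf
  obtain ⟨q, hq⟩ := hg
  exact ⟨p * q, fun n => by rw [Polynomial.eval_mul]; exact Nat.mul_le_mul (hp n) (hq n)⟩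

/-! ### Numbering the vertices -/

/-- The first `k` edges and `k + 1` vertices have been numbered. `E₀ i` and `E₁ i` are the ends of
the `i`-th edge of the list, `Y j` is the vertex with number `j`, `idx` is the inverse of `Y`
(increased by one, and zero for vertices without number), the edge number `j` joins `X j` to
`Y (j + 1)` and is the edge `ei j` of the list, and `P` is the parent function of the subdivided
tree. -/
structure Numbered (n : ℕ) (E₀ E₁ idx P X Y ei : ℕ → ℕ) (k : ℕ) : Prop where
  idx_Y : ∀ j ≤ k, Y j < n ∧ idx (Y j) = j + 1
  Y_idx : ∀ v, idx v ≠ 0 → idx v ≤ k + 1 ∧ Y (idx v - 1) = v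
  edge : ∀ j < k, ei j < n - 1 ∧ ((E₀ (ei j) = X j ∧ E₁ (ei j) = Y (j + 1)) ∨
    (E₁ (ei j) = X j ∧ E₀ (ei j) = Y (j + 1)))
  parent : ∀ j < k, idx (X j) ≠ 0 ∧ idx (X j) ≤ j + 1 ∧ P (2 * j + 1) = 2 * (idx (X j) - 1) ∧
    P (2 * j + 2) = 2 * j + 1
  P_zero : P 0 = 0
  P_lt : ∀ x, 0 < x → P x < x

/-- The map `Y` is injective on the numbers given so far, as `idx` inverts it. -/
theorem Numbered.lt {n : ℕ} {E₀ E₁ idx P X Y ei : ℕ → ℕ} {k : ℕ}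
    (h : Numbered n E₀ E₁ idx P X Y ei k) : k < n := by
  have : (Finset.range (k + 1)).card ≤ (Finset.range n).card := by
    refine Finset.card_le_card_of_injOn Y (fun j hj => ?_) fun i hi j hj hij => ?_
    · have := Finset.mem_range.1 (Finset.mem_coe.1 hj)
      simpa using (h.idx_Y j (by omega)).1
    · have hi := Finset.mem_range.1 (Finset.mem_coe.1 hi)
      have hj := Finset.mem_range.1 (Finset.mem_coe.1 hj)
      have h1 := (h.idx_Y i (by omega)).2
      have h2 := (h.idx_Y j (by omega)).2
      rw [hij] at h1
      omega
  simpa using this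

open Function in
theorem Numbered.attach {n : ℕ} {E₀ E₁ idx P X Y ei : ℕ → ℕ} {k U V i : ℕ}
    (h : Numbered n E₀ E₁ idx P X Y ei k) (hU : idx U ≠ 0) (hV : idx V = 0) (hVn : V < n)
    (hi : i < n - 1) (hUV : (E₀ i = U ∧ E₁ i = V) ∨ (E₁ i = U ∧ E₀ i = V)) :
    Numbered n E₀ E₁ (update idx V (k + 2))
      (update (update P (2 * k + 1) (2 * (idx U - 1))) (2 * k + 2) (2 * k + 1))
      (update X k U) (update Y (k + 1) V) (update ei k i) (k + 1) := by
  have hidx : ∀ v, idx v ≠ 0 → update idx V (k + 2) v = idx v := fun v hv =>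
    update_of_ne (fun hh : v = V => hv (by rw [hh, hV])) _ _
  refine ⟨?_, ?_, ?_, ?_, ?_, ?_⟩
  · intro j hj
    rcases hj.lt_or_eq with hj | rfl
    · have h1 := h.idx_Y j (by omega)
      rw [update_of_ne (by omega), hidx _ (by omega)]
      exact h1
    · simp [hVn]
  · intro v hv
    by_cases hvV : v = V
    · subst hvV
      simp
    · rw [update_of_ne hvV] at hv ⊢
      have h1 := h.Y_idx v hv
      rw [update_of_ne (by omega)]
      exact ⟨by omega, h1.2⟩
  · intro j hj
    rcases Nat.lt_succ_iff_lt_or_eq.1 hj with hj | rfl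
    · simp only [update_of_ne (show j ≠ k by omega), update_of_ne (show j + 1 ≠ k + 1 by omega)]
      exact h.edge j hj
    · simp only [update_self]
      exact ⟨hi, hUV⟩
  · intro j hj
    rcases Nat.lt_succ_iff_lt_or_eq.1 hj with hj | rfl
    · have h1 := h.parent j hj
      simp only [update_of_ne (show j ≠ k by omega), hidx _ h1.1,
        update_of_ne (show 2 * j + 1 ≠ 2 * k + 2 by omega),
        update_of_ne (show 2 * j + 1 ≠ 2 * k + 1 by omega),
        update_of_ne (show 2 * j + 2 ≠ 2 * k + 2 by omega),
        update_of_ne (show 2 * j + 2 ≠ 2 * k + 1 by omega)]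
      exact h1
    · simp only [update_self, hidx _ hU, update_of_ne (show 2 * j + 1 ≠ 2 * j + 2 by omega)]
      exact ⟨hU, (h.Y_idx U hU).1, trivial, trivial⟩
  · rw [update_of_ne (by omega), update_of_ne (by omega), h.P_zero]
  · intro x hx
    have h1 := (h.Y_idx U hU).1
    by_cases h2 : x = 2 * k + 2
    · subst h2; simp
    rw [update_of_ne h2]
    by_cases h3 : x = 2 * k + 1
    · subst h3
      rw [update_self]
      omega
    rw [update_of_ne h3]
    exact h.P_lt x hx

/-- Give the next numbers to the edge number `nvar 3` of the list and to its end `V`, the other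
end `U` having a number already. -/
def attachCmd (U V : NExp) : Cmd :=
  .seq (.setNat 5 (.var 4) U) <|
  .seq (.setNat 6 (.add (.var 4) (.const 1)) V) <|
  .seq (.setNat 7 (.var 4) (.var 3)) <|
  .seq (.setNat 4 (.add (.add (.var 4) (.var 4)) (.const 1))
    (.add (.sub (.read 3 U) (.const 1)) (.sub (.read 3 U) (.const 1)))) <|
  .seq (.setNat 4 (.add (.add (.var 4) (.var 4)) (.const 2))
    (.add (.add (.var 4) (.var 4)) (.const 1))) <|
  .seq (.setNat 3 V (.add (.var 4) (.const 2))) <|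
  .setVar 4 (.add (.var 4) (.const 1))

/-- Attach the edge number `nvar 3` of the list if exactly one of its ends has a number. -/
def visitCmd : Cmd :=
  .ite (.conj (.nle (.const 1) (.read 3 (.read 0 (.var 3))))
      (.nle (.read 3 (.read 1 (.var 3))) (.const 0)))
    (attachCmd (.read 0 (.var 3)) (.read 1 (.var 3)))
    (.ite (.conj (.nle (.const 1) (.read 3 (.read 1 (.var 3))))
        (.nle (.read 3 (.read 0 (.var 3))) (.const 0)))
      (attachCmd (.read 1 (.var 3)) (.read 0 (.var 3))) .skip)

/-- One pass over the list of edges. -/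
def passCmd : Cmd :=
  .seq (.setVar 3 (.const 0)) <|
  .loop (.nle (.add (.var 3) (.const 2)) (.var 0)) <|
    .seq visitCmd (.setVar 3 (.add (.var 3) (.const 1)))

/-- Number the vertices and edges. -/
def numberCmd : Cmd :=
  .seq (.seq (.setNat 3 (.const 0) (.const 1)) (.setVar 2 (.var 0))) <|
  .loop (.nle (.const 1) (.var 2)) <|
    .seq (.setVar 2 (.sub (.var 2) (.const 1))) passCmd

/-- The parts of the memory that are constant or meaningful while the vertices are numbered. -/
structure NumberState (n : ℕ) (E₀ E₁ : ℕ → ℕ) (R : ℕ → ℕ → ℝ) (s : State) : Prop where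
  n_eq : s.nvar 0 = n
  E₀_eq : s.narr 0 = E₀
  E₁_eq : s.narr 1 = E₁
  cut_eq : s.narr 8 = 0
  lab_eq : s.narr 9 = 0
  R_eq : s.rarr = R
  numbered : Numbered n E₀ E₁ (s.narr 3) (s.narr 4) (s.narr 5) (s.narr 6) (s.narr 7) (s.nvar 4)

section Number

variable {n : ℕ} {E₀ E₁ : ℕ → ℕ} {R : ℕ → ℕ → ℝ}

theorem NumberState.attach {s : State} (h : NumberState n E₀ E₁ R s) {U V : NExp}
    (hUV : (U = .read 0 (.var 3) ∧ V = .read 1 (.var 3)) ∨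
      (U = .read 1 (.var 3) ∧ V = .read 0 (.var 3)))
    (hE : E₀ (s.nvar 3) < n ∧ E₁ (s.nvar 3) < n) (hi : s.nvar 3 < n - 1)
    (hU : s.narr 3 (U.val s) ≠ 0) (hV : s.narr 3 (V.val s) = 0) :
    NumberState n E₀ E₁ R ((attachCmd U V).post s) ∧
      ((attachCmd U V).post s).nvar 4 = s.nvar 4 + 1 ∧
      ((attachCmd U V).post s).nvar 3 = s.nvar 3 ∧
      ((attachCmd U V).post s).nvar 2 = s.nvar 2 := by
  have hE' : ((E₀ (s.nvar 3) = U.val s ∧ E₁ (s.nvar 3) = V.val s) ∨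
      (E₁ (s.nvar 3) = U.val s ∧ E₀ (s.nvar 3) = V.val s)) := by
    rcases hUV with ⟨rfl, rfl⟩ | ⟨rfl, rfl⟩ <;> simp [NExp.val, h.E₀_eq, h.E₁_eq]
  have hVn : V.val s < n := by
    rcases hE' with ⟨_, h2⟩ | ⟨_, h2⟩ <;> rw [← h2]
    exacts [hE.2, hE.1]
  have key := h.numbered.attach hU hV hVn hi hE'
  rcases hUV with ⟨rfl, rfl⟩ | ⟨rfl, rfl⟩ <;>
  · refine ⟨⟨?_, ?_, ?_, ?_, ?_, ?_, ?_⟩, ?_, ?_, ?_⟩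
    case _ => simpa [attachCmd, Cmd.post] using h.n_eq
    case _ => simpa [attachCmd, Cmd.post] using h.E₀_eq
    case _ => simpa [attachCmd, Cmd.post] using h.E₁_eq
    case _ => simpa [attachCmd, Cmd.post] using h.cut_eq
    case _ => simpa [attachCmd, Cmd.post] using h.lab_eq
    case _ => simpa [attachCmd, Cmd.post] using h.R_eq
    case _ => simpa [attachCmd, Cmd.post, NExp.val, two_mul] using key
    all_goals simp [attachCmd, Cmd.post, NExp.val]

theorem NumberState.visit {s : State} (h : NumberState n E₀ E₁ R s)
    (hE : E₀ (s.nvar 3) < n ∧ E₁ (s.nvar 3) < n) (hi : s.nvar 3 < n - 1) :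
    NumberState n E₀ E₁ R (visitCmd.post s) ∧ (visitCmd.post s).nvar 3 = s.nvar 3 ∧
      (visitCmd.post s).nvar 2 = s.nvar 2 ∧
      (((visitCmd.post s).nvar 4 = s.nvar 4 + 1 ∧
        ¬ (s.narr 3 (E₀ (s.nvar 3)) = 0 ↔ s.narr 3 (E₁ (s.nvar 3)) = 0)) ∨
      (visitCmd.post s).nvar 4 = s.nvar 4 ∧ (visitCmd.post s).narr 3 = s.narr 3 ∧
        (s.narr 3 (E₀ (s.nvar 3)) = 0 ↔ s.narr 3 (E₁ (s.nvar 3)) = 0)) := by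
  by_cases h1 : s.narr 3 (E₀ (s.nvar 3)) ≠ 0 ∧ s.narr 3 (E₁ (s.nvar 3)) = 0
  · have e : visitCmd.post s = (attachCmd (.read 0 (.var 3)) (.read 1 (.var 3))).post s := by
      rw [visitCmd, Cmd.post_ite_pos]
      simp only [Test.Holds, NExp.val, h.E₀_eq, h.E₁_eq]
      omega
    have := h.attach (Or.inl ⟨rfl, rfl⟩) hE hi (by simpa [NExp.val, h.E₀_eq] using h1.1)
      (by simpa [NExp.val, h.E₁_eq] using h1.2)
    rw [e]
    exact ⟨this.1, this.2.2.1, this.2.2.2, Or.inl ⟨this.2.1, by tauto⟩⟩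
  by_cases h2 : s.narr 3 (E₁ (s.nvar 3)) ≠ 0 ∧ s.narr 3 (E₀ (s.nvar 3)) = 0
  · have e : visitCmd.post s = (attachCmd (.read 1 (.var 3)) (.read 0 (.var 3))).post s := by
      rw [visitCmd, Cmd.post_ite_neg, Cmd.post_ite_pos]
      all_goals
        simp only [Test.Holds, NExp.val, h.E₀_eq, h.E₁_eq]
        omega
    have := h.attach (Or.inr ⟨rfl, rfl⟩) hE hi (by simpa [NExp.val, h.E₁_eq] using h2.1)
      (by simpa [NExp.val, h.E₀_eq] using h2.2)
    rw [e]
    exact ⟨this.1, this.2.2.1, this.2.2.2, Or.inl ⟨this.2.1, by tauto⟩⟩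
  · have e : visitCmd.post s = s := by
      rw [visitCmd, Cmd.post_ite_neg, Cmd.post_ite_neg, Cmd.post]
      all_goals
        simp only [Test.Holds, NExp.val, h.E₀_eq, h.E₁_eq]
        omega
    rw [e]
    exact ⟨h, rfl, rfl, Or.inr ⟨rfl, rfl, by tauto⟩⟩

theorem NumberState.setVar {s : State} (h : NumberState n E₀ E₁ R s) {x : ℕ} (v : ℕ) (hx0 : x ≠ 0)
    (hx4 : x ≠ 4) : NumberState n E₀ E₁ R { s with nvar := Function.update s.nvar x v } where
  n_eq := by simpa [Function.update_of_ne hx0.symm] using h.n_eq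
  E₀_eq := h.E₀_eq
  E₁_eq := h.E₁_eq
  cut_eq := h.cut_eq
  lab_eq := h.lab_eq
  R_eq := h.R_eq
  numbered := by simpa [Function.update_of_ne hx4.symm] using h.numbered

/-- No edge of the list joins a vertex with number to one without number. -/
def NoCrossing (m : ℕ) (E₀ E₁ idx : ℕ → ℕ) : Prop := ∀ i < m, (idx (E₀ i) = 0 ↔ idx (E₁ i) = 0)

/-- A bound for the number of operations of one pass. -/
def passCost (n : ℕ) : ℕ :=
  (Cmd.setVar 3 (.const 0)).maxCost +
    (n * ((Cmd.seq visitCmd (.setVar 3 (.add (.var 3) (.const 1)))).maxCost +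
      (Test.nle (.add (.var 3) (.const 2)) (.var 0)).cost) +
        (Test.nle (.add (.var 3) (.const 2)) (.var 0)).cost)

/-- A pass either numbers a new vertex or certifies that the numbered set is closed under adjacency.
As long as nothing is attached, the edges already scanned stay free of crossings. -/
theorem runs_pass (hE : ∀ i < n - 1, E₀ i < n ∧ E₁ i < n) {s : State} {r d : ℕ}
    (h : NumberState n E₀ E₁ R s) (hr : s.nvar 2 = r)
    (hd : d ≤ s.nvar 4 ∨ NoCrossing (n - 1) E₀ E₁ (s.narr 3)) :
    Runs passCmd s (passCost n) fun s' => NumberState n E₀ E₁ R s' ∧ s'.nvar 2 = r ∧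
      (d + 1 ≤ s'.nvar 4 ∨ NoCrossing (n - 1) E₀ E₁ (s'.narr 3)) := by
  refine Runs.seq (R := fun s' => NumberState n E₀ E₁ R s' ∧ s'.nvar 2 = r ∧ s'.nvar 3 = 0 ∧
    (d ≤ s'.nvar 4 ∨ NoCrossing (n - 1) E₀ E₁ (s'.narr 3)))
    (Runs.loopFree (by simp [Cmd.LoopFree]) ?_) fun s hs => ?_
  · refine ⟨h.setVar 0 (by omega) (by omega), ?_, ?_, ?_⟩ <;> simp [Cmd.post, NExp.val, hr, hd]
  · refine Runs.loop (fun k s => NumberState n E₀ E₁ R s ∧ s.nvar 2 = r ∧ s.nvar 3 + k = n ∧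
      (NoCrossing (n - 1) E₀ E₁ (s.narr 3) ∨ d + 1 ≤ s.nvar 4 ∨ (d ≤ s.nvar 4 ∧
        NoCrossing (s.nvar 3) E₀ E₁ (s.narr 3)))) ?_ ?_ n s ?_
    · rintro k s ⟨h1, h2, h3, h4⟩ hb
      simp only [Test.Holds, NExp.val, h1.n_eq] at hb
      have hi : s.nvar 3 < n - 1 := by omega
      refine ⟨k - 1, by omega, Runs.loopFree (by simp [Cmd.LoopFree, visitCmd, attachCmd]) ?_⟩
      obtain ⟨g1, g2, g3, g4⟩ := h1.visit (hE _ hi) hi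
      simp only [Cmd.post]
      refine ⟨g1.setVar _ (by omega) (by omega), ?_, ?_, ?_⟩
      · simp [g3, h2]
      · simp only [Function.update_self, NExp.val, g2]
        omega
      · simp only [Function.update_self, NExp.val, g2, ne_eq, Nat.reduceEqDiff, not_false_eq_true, Function.update_of_ne]
        rcases g4 with ⟨g4, g5⟩ | ⟨g4, g5, g6⟩
        · rw [g4]
          rcases h4 with h4 | h4 | h4
          · exact absurd (h4 _ hi) g5
          · omega
          · omega
        · rw [g4, g5]
          refine h4.imp id (Or.imp id (And.imp id fun h4 i hi => ?_))
          rcases Nat.lt_succ_iff_lt_or_eq.1 hi with hi | rfl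
          · exact h4 i hi
          · exact g6
    · rintro k s ⟨h1, h2, h3, h4⟩ hb
      simp only [Test.Holds, NExp.val, h1.n_eq] at hb
      refine ⟨h1, h2, ?_⟩
      rcases h4 with h4 | h4 | ⟨_, h4⟩
      · exact Or.inr h4
      · exact Or.inl h4
      · exact Or.inr fun i hi => h4 i (by omega)
    · obtain ⟨h1, h2, h3, h4⟩ := hs
      refine ⟨h1, h2, by omega, ?_⟩
      rcases h4 with h4 | h4
      · exact Or.inr (Or.inr ⟨h4, fun i hi => by omega⟩)
      · exact Or.inl h4

/-- A bound for the number of operations of `numberCmd`. -/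
def numberCost (n : ℕ) : ℕ :=
  (Cmd.seq (.setNat 3 (.const 0) (.const 1)) (.setVar 2 (.var 0))).maxCost +
    (n * ((Cmd.setVar 2 (.sub (.var 2) (.const 1))).maxCost + passCost n +
      (Test.nle (.const 1) (.var 2)).cost) + (Test.nle (.const 1) (.var 2)).cost)

/-- With every pass the number of attached edges grows unless the numbered set is closed. After `n`
passes it would be at least `n`, contradicting `Numbered.lt`. -/
theorem runs_number (hn : 0 < n) (hE : ∀ i < n - 1, E₀ i < n ∧ E₁ i < n) {s : State}
    (h0 : s.nvar 0 = n) (h1 : s.nvar 4 = 0) (hE₀ : s.narr 0 = E₀) (hE₁ : s.narr 1 = E₁)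
    (harr : ∀ a, 2 ≤ a → s.narr a = 0) (hR : s.rarr = R) :
    Runs numberCmd s (numberCost n) fun s' => NumberState n E₀ E₁ R s' ∧
      NoCrossing (n - 1) E₀ E₁ (s'.narr 3) := by
  refine Runs.seq (R := fun s' => NumberState n E₀ E₁ R s' ∧ s'.nvar 2 = n)
    (Runs.loopFree (by simp [Cmd.LoopFree]) ?_) fun s hs => ?_
  · refine ⟨⟨?_, ?_, ?_, ?_, ?_, ?_, ?_⟩, ?_⟩
    case _ => simpa [Cmd.post] using h0
    case _ => simpa [Cmd.post] using hE₀
    case _ => simpa [Cmd.post] using hE₁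
    case _ => simpa [Cmd.post] using harr 8 (by omega)
    case _ => simpa [Cmd.post] using harr 9 (by omega)
    case _ => simpa [Cmd.post] using hR
    case _ =>
      simp only [Cmd.post, NExp.val, Function.update_self, ne_eq, Nat.reduceEqDiff, not_false_eq_true, Function.update_of_ne, harr 3 (by omega),
        harr 4 (by omega), harr 5 (by omega), harr 6 (by omega), harr 7 (by omega), h1]
      -- The root is the vertex `0`: the zero entry in the array of numbered vertices already says
      -- so, and only its index had to be written.
      refine ⟨?_, ?_, by simp, by simp, rfl, fun x hx => hx⟩
      · intro j hj
        obtain rfl : j = 0 := by omega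
        simp [hn]
      · intro v hv
        by_cases hv0 : v = 0
        · subst hv0; simp
        · simp [Function.update_of_ne hv0] at hv
    case _ => simp [Cmd.post, NExp.val, h0]
  · refine Runs.loop (fun k s => NumberState n E₀ E₁ R s ∧ s.nvar 2 = k ∧ k ≤ n ∧
      (n - k ≤ s.nvar 4 ∨ NoCrossing (n - 1) E₀ E₁ (s.narr 3))) ?_ ?_ n s ?_
    · rintro k s ⟨h1, h2, h3, h4⟩ hb
      simp only [Test.Holds, NExp.val, h2] at hb
      refine ⟨k - 1, by omega, ?_⟩
      refine Runs.seq (R := fun s' => NumberState n E₀ E₁ R s' ∧ s'.nvar 2 = k - 1 ∧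
        (n - k ≤ s'.nvar 4 ∨ NoCrossing (n - 1) E₀ E₁ (s'.narr 3)))
        (Runs.loopFree (by simp [Cmd.LoopFree]) ?_) fun s hs => ?_
      · refine ⟨h1.setVar _ (by omega) (by omega), ?_, ?_⟩
        · simp [Cmd.post, NExp.val, h2]
        · simpa [Cmd.post] using h4
      · refine (runs_pass hE hs.1 hs.2.1 hs.2.2).mono le_rfl ?_
        rintro s ⟨g1, g2, g3⟩
        exact ⟨g1, g2, by omega, g3.imp (by omega) id⟩
    · rintro k s ⟨h1, h2, h3, h4⟩ hb
      simp only [Test.Holds, NExp.val, h2] at hb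
      refine ⟨h1, h4.resolve_left ?_⟩
      have := h1.numbered.lt
      omega
    · exact ⟨hs.1, hs.2, le_rfl, Or.inl (by omega)⟩

end Number

end RealRAM

/-! ### Computing the cut -/

namespace TreeMulticut

theorem GreedyInv.descend {γ : Type*} {p : ℕ → ℕ} {N : ℕ} {Conf : ℕ → ℕ → Prop} {C : Finset ℕ}
    {z : ℕ} (h : GreedyInv γ p N Conf (z + 1) (z + 1) C) : GreedyInv γ p N Conf z (z + 1) C :=
  ⟨fun y hy hy0 => (Nat.le_succ z).trans (h.le_parent y hy hy0), h.separated, h.card_le⟩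

theorem GreedyInv.complete {γ : Type*} {p : ℕ → ℕ} {N : ℕ} {Conf : ℕ → ℕ → Prop} {C : Finset ℕ}
    {z : ℕ} (h : GreedyInv γ p N Conf z (z + 1) C)
    (hz : ∀ a b, Conf a b → ¬ (Climb p C a z ∧ Climb p C b z)) :
    GreedyInv γ p N Conf z z C := by
  refine ⟨h.le_parent, fun z' hz' => ?_, h.card_le⟩
  rcases hz'.lt_or_eq with h' | rfl
  · exact h.separated z' h'
  · exact hz

end TreeMulticut

namespace RealRAM

open TreeDrawing TreeMulticut

/-- The point with number `k` in the memory for real numbers. -/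
noncomputable def point (R : ℕ → ℕ → ℝ) (k : ℕ) : Plane := !₂[R 0 k, R 1 k]

theorem inner_point_sub (R : ℕ → ℕ → ℝ) (w v u : ℕ) :
    inner ℝ (point R w - point R v) (point R v - point R u) =
      (R 0 w - R 0 v) * (R 0 v - R 0 u) + (R 1 w - R 1 v) * (R 1 v - R 1 u) := by
  simp [point, PiLp.inner_apply, Fin.sum_univ_two, mul_comm]

/-- The point `w` lies beyond the end `v` of the segment `u v`. -/
def beyondTest (w v u : NExp) : Test :=
  .rle (.const 0) (.add
    (.mul (.sub (.read 0 w) (.read 0 v)) (.sub (.read 0 v) (.read 0 u)))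
    (.mul (.sub (.read 1 w) (.read 1 v)) (.sub (.read 1 v) (.read 1 u))))

theorem beyondTest_holds (s : State) (w v u : NExp) : (beyondTest w v u).Holds s ↔
    0 ≤ inner ℝ (point s.rarr (w.val s) - point s.rarr (v.val s))
      (point s.rarr (v.val s) - point s.rarr (u.val s)) := by
  rw [inner_point_sub]
  simp [beyondTest, Test.Holds, RExp.val]

/-- The edges with the numbers `nvar 6` and `nvar 7` are different and in conflict. -/
def conflictTest : Test :=
  let u : NExp := .read 5 (.var 6)
  let v : NExp := .read 6 (.add (.var 6) (.const 1))
  let x : NExp := .read 5 (.var 7)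
  let y : NExp := .read 6 (.add (.var 7) (.const 1))
  .conj (.neg (.conj (.nle (.var 6) (.var 7)) (.nle (.var 7) (.var 6))))
    (.conj (.neg (.conj (beyondTest x v u) (beyondTest y v u)))
      (.neg (.conj (beyondTest x u v) (beyondTest y u v))))

/-- The nodes `a` and `b` of the subdivided tree belong to edges in conflict. -/
def NodeConflict (m : ℕ) (X Y : ℕ → ℕ) (R : ℕ → ℕ → ℝ) (a b : ℕ) : Prop :=
  ∃ i < m, ∃ j < m, a = 2 * i + 1 ∧ b = 2 * j + 1 ∧ i ≠ j ∧
    ¬ SameSide (point R (X i)) (point R (Y (i + 1))) (point R (X j)) (point R (Y (j + 1)))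

/-- The memory that is constant while the cut is computed. -/
structure CutFrame (n : ℕ) (P X Y ei : ℕ → ℕ) (R : ℕ → ℕ → ℝ) (s : State) : Prop where
  n_eq : s.nvar 0 = n
  P_eq : s.narr 4 = P
  X_eq : s.narr 5 = X
  Y_eq : s.narr 6 = Y
  ei_eq : s.narr 7 = ei
  lab_eq : s.narr 9 = 0
  R_eq : s.rarr = R

section Cut

variable {n : ℕ} {P X Y ei : ℕ → ℕ} {R : ℕ → ℕ → ℝ}

theorem CutFrame.congr {s s' : State} (h : CutFrame n P X Y ei R s) (h0 : s'.nvar 0 = s.nvar 0)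
    (h1 : s'.narr = s.narr) (h2 : s'.rarr = s.rarr) : CutFrame n P X Y ei R s' := by
  obtain ⟨a, b, c, d, e, f, g⟩ := h
  exact ⟨h0 ▸ a, h1 ▸ b, h1 ▸ c, h1 ▸ d, h1 ▸ e, h1 ▸ f, h2 ▸ g⟩

theorem conflictTest_holds {s : State} (h : CutFrame n P X Y ei R s) (ha : s.nvar 6 < n - 1)
    (hb : s.nvar 7 < n - 1) : conflictTest.Holds s ↔
      NodeConflict (n - 1) X Y R (2 * s.nvar 6 + 1) (2 * s.nvar 7 + 1) := by
  simp only [conflictTest, Test.Holds, beyondTest_holds, NExp.val, h.X_eq, h.Y_eq, h.R_eq]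
  constructor
  · rintro ⟨h1, h2, h3⟩
    exact ⟨_, ha, _, hb, rfl, rfl, by omega, fun hS => hS.elim h2 h3⟩
  · rintro ⟨i, hi, j, hj, h1, h2, h3, h4⟩
    obtain rfl : s.nvar 6 = i := by omega
    obtain rfl : s.nvar 7 = j := by omega
    exact ⟨by omega, fun h => h4 (Or.inl h), fun h => h4 (Or.inr h)⟩

/-! ### Climbing to a node -/

/-- Not yet at height `nvar 5`, and the edge to the parent is not cut. -/
def climbTest (u : ℕ) : Test :=
  .conj (.neg (.nle (.var u) (.var 5))) (.nle (.read 8 (.var u)) (.const 0))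

/-- Move from `u` to its parent and keep the previous node in `c`. -/
def climbStep (u c : ℕ) : Cmd := .seq (.setVar c (.var u)) (.setVar u (.read 4 (.var u)))

/-- Put the node of the edge number `a` into `u`. -/
def climbInit (a u c : ℕ) : Cmd :=
  .seq (.setVar u (.add (.add (.var a) (.var a)) (.const 1))) (.setVar c (.const 0))

/-- Climb from the node of the edge number `a` to the node `nvar 5`, or as far as possible. -/
def climbCmd (a u c : ℕ) : Cmd := .seq (climbInit a u c) (.loop (climbTest u) (climbStep u c))

/-- A bound for the number of operations of `climbCmd`. -/
def climbCost (a u c n : ℕ) : ℕ :=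
  (climbInit a u c).maxCost +
    ((n + n) * ((climbStep u c).maxCost + (climbTest u).cost) + (climbTest u).cost)

/-- Uncut upward paths are unique, so a climb that reaches `z` passes through the current node. If
the loop stops elsewhere, it is below `z` or at a cut link, and `z` cannot be reached. The current
node itself bounds the remaining iterations, since parents are smaller. -/
theorem runs_climb {C : Finset ℕ} (hP : ∀ x, 0 < x → P x < x) {a u c : ℕ} (huc : u ≠ c)
    (hu : u ≠ 5) (hc : c ≠ 5) {s : State} (hPs : s.narr 4 = P)
    (hC : ∀ x, s.narr 8 x ≠ 0 ↔ x ∈ C) (ha : s.nvar a < n - 1) :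
    Runs (climbCmd a u c) s (climbCost a u c n) fun s' => s'.narr = s.narr ∧ s'.rarr = s.rarr ∧
      (∀ x, x ≠ u → x ≠ c → s'.nvar x = s.nvar x) ∧
      ((s'.nvar u = s.nvar 5 ∧ ((2 * s.nvar a + 1 = s.nvar 5 ∧ s'.nvar c = 0) ∨
          ClimbLast P C (s.nvar 5) (2 * s.nvar a + 1) (s'.nvar c))) ∨
        (s'.nvar u ≠ s.nvar 5 ∧ ¬ Climb P C (2 * s.nvar a + 1) (s.nvar 5))) := by
  set A := 2 * s.nvar a + 1 with hA
  set z := s.nvar 5 with hz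
  set I : ℕ → State → Prop := fun k s' => s'.narr = s.narr ∧ s'.rarr = s.rarr ∧
      (∀ x, x ≠ u → x ≠ c → s'.nvar x = s.nvar x) ∧ s'.nvar u ≤ k ∧
      ((s'.nvar u = A ∧ s'.nvar c = 0) ∨ ClimbLast P C (s'.nvar u) A (s'.nvar c)) ∧
      (Climb P C A z → Climb P C (s'.nvar u) z) with hI
  refine Runs.seq (R := I (n + n)) (Runs.loopFree (by simp [Cmd.LoopFree, climbInit]) ?_)
    fun s' hs' => Runs.loop I ?_ ?_ (n + n) s' hs'
  · have h1 : ((climbInit a u c).post s).nvar u = A := by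
      simp only [climbInit, Cmd.post, NExp.val, Function.update_of_ne huc, Function.update_self]
      omega
    refine ⟨rfl, rfl, fun x hxu hxc => ?_, ?_, Or.inl ⟨h1, ?_⟩, fun h => by rwa [h1]⟩
    · simp [climbInit, Cmd.post, Function.update_of_ne hxu, Function.update_of_ne hxc]
    · omega
    · simp [climbInit, Cmd.post, NExp.val]
  · rintro k s' ⟨h1, h2, h3, h4, h5, h6⟩ hb
    simp only [climbTest, Test.Holds, NExp.val, h3 5 hu.symm hc.symm, ← hz, h1] at hb
    have huC : s'.nvar u ∉ C := fun h => ((hC _).2 h) (by omega)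
    have hu0 : 0 < s'.nvar u := by omega
    have hlt := hP _ hu0
    refine ⟨k - 1, by omega, Runs.loopFree (by simp [Cmd.LoopFree, climbStep]) ?_⟩
    have e1 : ((climbStep u c).post s').nvar u = P (s'.nvar u) := by
      simp [climbStep, Cmd.post, NExp.val, Function.update_of_ne huc, h1, hPs]
    have e2 : ((climbStep u c).post s').nvar c = s'.nvar u := by
      simp [climbStep, Cmd.post, NExp.val, Function.update_of_ne huc.symm]
    refine ⟨h1, h2, fun x hxu hxc => ?_, ?_, ?_, ?_⟩
    · simp [climbStep, Cmd.post, Function.update_of_ne hxu, Function.update_of_ne hxc, h3 x hxu hxc]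
    · rw [e1]; omega
    · rw [e1, e2]
      right
      rcases h5 with ⟨h5, _⟩ | h5
      · rw [h5] at hu0 huC ⊢
        exact .base hu0 huC rfl
      · exact h5.extend hu0 huC
    · rw [e1]
      intro h
      rcases (h6 h).eq_or with h | h
      · omega
      · exact h.2.2
  · rintro k s' ⟨h1, h2, h3, h4, h5, h6⟩ hb
    simp only [climbTest, Test.Holds, NExp.val, h3 5 hu.symm hc.symm, ← hz, h1] at hb
    refine ⟨h1, h2, h3, ?_⟩
    by_cases huz : s'.nvar u = z
    · left
      rw [huz] at h5
      exact ⟨huz, h5.imp (And.imp Eq.symm id) id⟩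
    · refine Or.inr ⟨huz, fun h => ?_⟩
      have hcl := h6 h
      have hle := hcl.le hP
      have huC : s'.nvar u ∈ C := (hC _).1 (by omega)
      exact hcl.eq_or.elim huz fun h => h.2.1 huC

/-- Cut the last edges if both climbs have reached the node `nvar 5`. -/
def cutCmd : Cmd :=
  .ite (.conj (.conj (.nle (.var 8) (.var 5)) (.nle (.var 5) (.var 8)))
      (.conj (.nle (.var 10) (.var 5)) (.nle (.var 5) (.var 10))))
    (.seq (.setNat 8 (.var 9) (.const 1)) (.setNat 8 (.var 11) (.const 1))) .skip

/-- Process the pair of the edges `nvar 6` and `nvar 7` at the node `nvar 5`. -/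
def pairCmd : Cmd :=
  .ite conflictTest (.seq (climbCmd 6 8 9) (.seq (climbCmd 7 10 11) cutCmd)) .skip

/-- A bound for the number of operations of `pairCmd`. -/
def pairCost (n : ℕ) : ℕ :=
  conflictTest.cost + ((climbCost 6 8 9 n + (climbCost 7 10 11 n + cutCmd.maxCost)) +
    Cmd.skip.maxCost)

/-- The pairs in `S` have been processed at the node `z`. -/
structure CutState (γ : Type*) (n : ℕ) (P X Y ei : ℕ → ℕ) (R : ℕ → ℕ → ℝ) (z : ℕ)
    (S : ℕ → ℕ → Prop) (s : State) : Prop where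
  frame : CutFrame n P X Y ei R s
  z_eq : s.nvar 5 = z
  cut : ∃ C : Finset ℕ, (∀ x, s.narr 8 x ≠ 0 ↔ x ∈ C) ∧
    GreedyInv γ P (2 * (n - 1) + 1) (NodeConflict (n - 1) X Y R) z (z + 1) C ∧
    ∀ a b, S a b → NodeConflict (n - 1) X Y R (2 * a + 1) (2 * b + 1) →
      ¬ (Climb P C (2 * a + 1) z ∧ Climb P C (2 * b + 1) z)

variable {γ : Type*}

/-- Pairs outside the range of edges are never in conflict and may be declared processed. This is
how the loops over pairs start with their counter at `n - 1`. -/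
theorem CutState.setVar {z : ℕ} {S S' : ℕ → ℕ → Prop} {s : State}
    (h : CutState γ n P X Y ei R z S s) {x : ℕ} (v : ℕ) (hx0 : x ≠ 0) (hx5 : x ≠ 5)
    (hS : ∀ a b, S' a b → S a b ∨ n - 1 ≤ a ∨ n - 1 ≤ b) :
    CutState γ n P X Y ei R z S' { s with nvar := Function.update s.nvar x v } := by
  obtain ⟨h1, h2, C, hC, hI, hD⟩ := h
  refine ⟨h1.congr (by simp [Function.update_of_ne hx0.symm]) rfl rfl,
    by simpa [Function.update_of_ne hx5.symm] using h2, C, hC, hI, fun a b hab hconf => ?_⟩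
  rcases hS a b hab with h | h
  · exact hD a b h hconf
  · obtain ⟨i, hi, j, hj, h1, h2, _⟩ := hconf
    omega

theorem runs_pair (hP : ∀ x, 0 < x → P x < x) {z a b : ℕ} {S : ℕ → ℕ → Prop} {s : State}
    (h : CutState γ n P X Y ei R z S s) (ha : s.nvar 6 = a) (hb : s.nvar 7 = b)
    (han : a < n - 1) (hbn : b < n - 1) :
    Runs pairCmd s (pairCost n) fun s' =>
      CutState γ n P X Y ei R z (fun a' b' => S a' b' ∨ (a' = a ∧ b' = b)) s' ∧
      s'.nvar 6 = a ∧ s'.nvar 7 = b := by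
  obtain ⟨hF, hz, C, hC, hI, hD⟩ := h
  have hiff := conflictTest_holds hF (by omega) (by omega)
  rw [ha, hb] at hiff
  refine Runs.ite (fun ht => ?_) fun ht => ?_
  · have hconf := hiff.1 ht
    refine (runs_climb (n := n) (C := C) hP (by omega) (by omega) (by omega) hF.P_eq hC (by omega)).seq
      fun s₁ ⟨g1, g2, g3, g4⟩ => ?_
    have e5 := g3 5 (by omega) (by omega)
    have e6 := g3 6 (by omega) (by omega)
    have e7 := g3 7 (by omega) (by omega)
    refine (runs_climb (n := n) (C := C) (s := s₁) hP (by omega) (by omega) (by omega)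
      (by rw [g1, hF.P_eq]) (by rw [g1]; exact hC) (by omega)).seq
      fun s₂ ⟨k1, k2, k3, k4⟩ => Runs.loopFree (by simp [Cmd.LoopFree, cutCmd]) ?_
    have f0 := (k3 0 (by omega) (by omega)).trans (g3 0 (by omega) (by omega))
    have f5 := (k3 5 (by omega) (by omega)).trans e5
    have f6 := (k3 6 (by omega) (by omega)).trans e6
    have f7 := (k3 7 (by omega) (by omega)).trans e7
    have f8 := k3 8 (by omega) (by omega)
    have f9 := k3 9 (by omega) (by omega)
    rw [e5, e7, hb, hz] at k4
    rw [ha, hz] at g4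
    have hF₂ : CutFrame n P X Y ei R s₂ := hF.congr f0 (k1.trans g1) (k2.trans g2)
    -- If both climbs arrive, their last links are cut. If one fails, the cut made so far already
    -- prevents the pair from meeting at `z`.
    by_cases hboth : s₂.nvar 8 = z ∧ s₂.nvar 10 = z
    · have e : cutCmd.post s₂ = (Cmd.seq (.setNat 8 (.var 9) (.const 1))
          (.setNat 8 (.var 11) (.const 1))).post s₂ := by
        rw [cutCmd, Cmd.post_ite_pos]
        simp only [Test.Holds, NExp.val, f5, hz]
        omega
      rw [e]
      have ha' := (g4.resolve_right fun h => h.1 (f8 ▸ hboth.1)).2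
      have hb' := (k4.resolve_right fun h => h.1 hboth.2).2
      rw [← f9] at ha'
      refine ⟨⟨?_, ?_, insert (s₂.nvar 9) (insert (s₂.nvar 11) C), ?_, ?_, ?_⟩, ?_, ?_⟩
      · obtain ⟨q1, q2, q3, q4, q5, q6, q7⟩ := hF₂
        constructor <;> simp [Cmd.post, q1, q2, q3, q4, q5, q6, q7]
      · simpa [Cmd.post, f5] using hz
      · intro x
        have hC₂ : s₂.narr 8 x ≠ 0 ↔ x ∈ C := by rw [k1, g1]; exact hC x
        simp only [Cmd.post, NExp.val, Function.update_self, Finset.mem_insert, ← hC₂]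
        by_cases h11 : x = s₂.nvar 11
        · subst h11; simp
        · rw [Function.update_of_ne h11]
          by_cases h9 : x = s₂.nvar 9
          · subst h9; simp
          · simp [h9, h11]
      · exact hI.cut hP (fun a b ⟨i, hi, j, hj, h1, h2, _⟩ => by omega) hconf ha' hb'
      · have hsub : C ⊆ insert (s₂.nvar 9) (insert (s₂.nvar 11) C) := fun x hx => by simp [hx]
        rintro a' b' (hab | ⟨rfl, rfl⟩) hconf'
        · exact fun h => hD a' b' hab hconf' ⟨h.1.anti hsub, h.2.anti hsub⟩
        · refine not_climb_of_cut hP ?_ ha' hb'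
          obtain ⟨i, hi, j, hj, h1, h2, h3, _⟩ := hconf'
          omega
      · simp [Cmd.post, f6, ha]
      · simp [Cmd.post, f7, hb]
    · have e : cutCmd.post s₂ = s₂ := by
        rw [cutCmd, Cmd.post_ite_neg, Cmd.post]
        simp only [Test.Holds, NExp.val, f5, hz]
        omega
      rw [e]
      refine ⟨⟨hF₂, f5.trans hz, C, by rw [k1, g1]; exact hC, hI, ?_⟩, f6.trans ha, f7.trans hb⟩
      rintro a' b' (hab | ⟨rfl, rfl⟩) hconf'
      · exact hD a' b' hab hconf'
      · rintro ⟨h1, h2⟩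
        refine hboth ⟨?_, ?_⟩
        · rw [f8]
          exact (g4.resolve_right fun h => h.2 h1).1
        · exact (k4.resolve_right fun h => h.2 h2).1
  · refine Runs.loopFree (by exact trivial) ?_
    refine ⟨⟨hF, hz, C, hC, hI, ?_⟩, ha, hb⟩
    rintro a' b' (hab | ⟨rfl, rfl⟩) hconf'
    · exact hD a' b' hab hconf'
    · exact absurd (hiff.2 hconf') ht

/-! ### Loops over pairs and over nodes -/

/-- The counter `x` is positive. -/
def posTest (x : ℕ) : Test := .nle (.const 1) (.var x)

/-- Decrease the counter `x`. -/
def decCmd (x : ℕ) : Cmd := .setVar x (.sub (.var x) (.const 1))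

/-- Set the counter `x` to the number of edges. -/
def startCmd (x : ℕ) : Cmd := .setVar x (.sub (.var 0) (.const 1))

/-- Process all pairs with first edge `nvar 6` at the node `nvar 5`. -/
def rowCmd : Cmd := .seq (startCmd 7) (.loop (posTest 7) (.seq (decCmd 7) pairCmd))

/-- A bound for the number of operations of `rowCmd`. -/
def rowCost (n : ℕ) : ℕ :=
  (startCmd 7).maxCost +
    (n * ((decCmd 7).maxCost + pairCost n + (posTest 7).cost) + (posTest 7).cost)

theorem runs_row (hP : ∀ x, 0 < x → P x < x) {z a : ℕ} {s : State}
    (h : CutState γ n P X Y ei R z (fun a' _ => a + 1 ≤ a') s) (ha : s.nvar 6 = a)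
    (han : a < n - 1) :
    Runs rowCmd s (rowCost n) fun s' =>
      CutState γ n P X Y ei R z (fun a' _ => a ≤ a') s' ∧ s'.nvar 6 = a := by
  set I : ℕ → State → Prop := fun k s' =>
    CutState γ n P X Y ei R z (fun a' b' => a + 1 ≤ a' ∨ (a' = a ∧ s'.nvar 7 ≤ b')) s' ∧
      s'.nvar 6 = a ∧ s'.nvar 7 ≤ k ∧ s'.nvar 7 ≤ n - 1 with hI
  refine Runs.seq (R := I n) (Runs.loopFree (by exact trivial) ?_) fun s' hs' =>
    Runs.loop I ?_ ?_ n s' hs'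
  · refine ⟨h.setVar _ (by omega) (by omega) ?_, ?_, ?_, ?_⟩
    · rintro a' b' (hab | ⟨_, hab⟩)
      · exact Or.inl hab
      · simp [startCmd, Cmd.post, NExp.val, h.frame.n_eq] at hab ⊢
        omega
    all_goals simp [startCmd, Cmd.post, NExp.val, h.frame.n_eq, ha]
  · rintro k s ⟨h1, h2, h3, h4⟩ hb
    simp only [posTest, Test.Holds, NExp.val] at hb
    refine ⟨k - 1, by omega, ?_⟩
    refine Runs.seq (R := fun s' => CutState γ n P X Y ei R z
      (fun a' b' => a + 1 ≤ a' ∨ (a' = a ∧ s.nvar 7 ≤ b')) s' ∧ s'.nvar 6 = a ∧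
        s'.nvar 7 = s.nvar 7 - 1) (Runs.loopFree (by exact trivial) ?_) fun s' hs' => ?_
    · refine ⟨h1.setVar _ (by omega) (by omega) fun _ _ h => Or.inl h, ?_, ?_⟩ <;>
        simp [decCmd, Cmd.post, NExp.val, h2]
    · refine (runs_pair hP hs'.1 hs'.2.1 hs'.2.2 han (by omega)).mono le_rfl ?_
      rintro s'' ⟨⟨g1, g2, C, g3, g4, g5⟩, g6, g7⟩
      refine ⟨⟨g1, g2, C, g3, g4, fun a' b' hab => g5 a' b' ?_⟩, g6, by omega, by omega⟩
      omega
  · rintro k s ⟨⟨g1, g2, C, g3, g4, g5⟩, h2, h3, h4⟩ hb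
    simp only [posTest, Test.Holds, NExp.val] at hb
    exact ⟨⟨g1, g2, C, g3, g4, fun a' b' hab => g5 a' b' (by omega)⟩, h2⟩

/-- Process all pairs at the node `nvar 5`. -/
def nodeCmd : Cmd := .seq (startCmd 6) (.loop (posTest 6) (.seq (decCmd 6) rowCmd))

/-- A bound for the number of operations of `nodeCmd`. -/
def nodeCost (n : ℕ) : ℕ :=
  (startCmd 6).maxCost +
    (n * ((decCmd 6).maxCost + rowCost n + (posTest 6).cost) + (posTest 6).cost)

theorem runs_node (hP : ∀ x, 0 < x → P x < x) {z : ℕ} {s : State}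
    (h : CutState γ n P X Y ei R z (fun _ _ => False) s) :
    Runs nodeCmd s (nodeCost n) (CutState γ n P X Y ei R z fun _ _ => True) := by
  set I : ℕ → State → Prop := fun k s' =>
    CutState γ n P X Y ei R z (fun a' _ => s'.nvar 6 ≤ a') s' ∧ s'.nvar 6 ≤ k ∧
      s'.nvar 6 ≤ n - 1 with hI
  refine Runs.seq (R := I n) (Runs.loopFree (by exact trivial) ?_) fun s' hs' =>
    Runs.loop I ?_ ?_ n s' hs'
  · refine ⟨h.setVar _ (by omega) (by omega) ?_, ?_, ?_⟩
    · intro a' b' hab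
      simp [startCmd, Cmd.post, NExp.val, h.frame.n_eq] at hab ⊢
      omega
    all_goals simp [startCmd, Cmd.post, NExp.val, h.frame.n_eq]
  · rintro k s ⟨h1, h3, h4⟩ hb
    simp only [posTest, Test.Holds, NExp.val] at hb
    refine ⟨k - 1, by omega, ?_⟩
    refine Runs.seq (R := fun s' => CutState γ n P X Y ei R z
      (fun a' _ => s.nvar 6 - 1 + 1 ≤ a') s' ∧ s'.nvar 6 = s.nvar 6 - 1)
      (Runs.loopFree (by exact trivial) ?_) fun s' hs' => ?_
    · refine ⟨h1.setVar _ (by omega) (by omega) fun _ _ h => Or.inl (by omega), ?_⟩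
      simp [decCmd, Cmd.post, NExp.val]
    · refine (runs_row hP hs'.1 hs'.2 (by omega)).mono le_rfl ?_
      rintro s'' ⟨g1, g2⟩
      refine ⟨g2 ▸ g1, by omega, by omega⟩
  · rintro k s ⟨⟨g1, g2, C, g3, g4, g5⟩, h3, h4⟩ hb
    simp only [posTest, Test.Holds, NExp.val] at hb
    exact ⟨g1, g2, C, g3, g4, fun a' b' _ => g5 a' b' (by omega)⟩

/-- Set `nvar 5` to the number of nodes. -/
def cutInit : Cmd := .setVar 5 (.sub (.add (.var 0) (.var 0)) (.const 1))

/-- Compute the cut. -/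
def cutAllCmd : Cmd := .seq cutInit (.loop (posTest 5) (.seq (decCmd 5) nodeCmd))

/-- A bound for the number of operations of `cutAllCmd`. -/
def cutAllCost (n : ℕ) : ℕ :=
  cutInit.maxCost +
    ((n + n) * ((decCmd 5).maxCost + nodeCost n + (posTest 5).cost) + (posTest 5).cost)

/-- The node counter runs down from the number of nodes, where no edge node can climb to, and at `0`
the invariant covers all common nodes of climbs. -/
theorem runs_cutAll (hn : 0 < n) (hP : ∀ x, 0 < x → P x < x) {s : State}
    (h : CutFrame n P X Y ei R s) (hcut : s.narr 8 = 0) :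
    Runs cutAllCmd s (cutAllCost n) fun s' => CutFrame n P X Y ei R s' ∧
      ∃ C : Finset ℕ, (∀ x, s'.narr 8 x ≠ 0 ↔ x ∈ C) ∧
        GreedyInv γ P (2 * (n - 1) + 1) (NodeConflict (n - 1) X Y R) 0 0 C := by
  set I : ℕ → State → Prop := fun k s' => CutFrame n P X Y ei R s' ∧ s'.nvar 5 ≤ k ∧
    ∃ C : Finset ℕ, (∀ x, s'.narr 8 x ≠ 0 ↔ x ∈ C) ∧
      GreedyInv γ P (2 * (n - 1) + 1) (NodeConflict (n - 1) X Y R) (s'.nvar 5) (s'.nvar 5) C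
    with hI
  refine Runs.seq (R := I (n + n)) (Runs.loopFree (by exact trivial) ?_) fun s' hs' =>
    Runs.loop I ?_ ?_ (n + n) s' hs'
  · have h5 : (cutInit.post s).nvar 5 = 2 * (n - 1) + 1 := by
      simp only [cutInit, Cmd.post, NExp.val, Function.update_self, h.n_eq]
      omega
    refine ⟨h.congr (by simp [cutInit, Cmd.post]) rfl rfl, by omega, ∅, ?_, ?_⟩
    · simp [cutInit, Cmd.post, hcut]
    · rw [h5]
      exact GreedyInv.init γ hP fun a b ⟨i, hi, j, hj, h1, h2, _⟩ => by omega
  · rintro k s ⟨h1, h2, C, h3, h4⟩ hb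
    simp only [posTest, Test.Holds, NExp.val] at hb
    obtain ⟨z, hz⟩ : ∃ z, s.nvar 5 = z + 1 := ⟨s.nvar 5 - 1, by omega⟩
    rw [hz] at h4
    refine ⟨k - 1, by omega, ?_⟩
    refine Runs.seq (R := CutState γ n P X Y ei R z fun _ _ => False)
      (Runs.loopFree (by exact trivial) ?_) fun s' hs' => ?_
    · refine ⟨h1.congr (by simp [decCmd, Cmd.post]) rfl rfl, by simp [decCmd, Cmd.post, NExp.val, hz],
        C, h3, h4.descend, fun _ _ h => h.elim⟩
    · refine (runs_node hP hs').mono le_rfl ?_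
      rintro s'' ⟨g1, g2, C', g3, g4, g5⟩
      refine ⟨g1, by omega, C', g3, ?_⟩
      rw [g2]
      refine g4.complete fun a b hab => ?_
      obtain ⟨i, hi, j, hj, rfl, rfl, _⟩ := id hab
      exact g5 i j trivial hab
  · rintro k s ⟨h1, h2, C, h3, h4⟩ hb
    simp only [posTest, Test.Holds, NExp.val] at hb
    rw [show s.nvar 5 = 0 by omega] at h4
    exact ⟨h1, C, h3, h4⟩

end Cut

/-! ### Computing the labels -/

/-- Compute the label of the node `nvar 12`. -/
def labelStep : Cmd :=
  .seq (.ite (.nle (.const 1) (.read 8 (.var 12))) (.setNat 9 (.var 12) (.var 12))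
    (.setNat 9 (.var 12) (.read 9 (.read 4 (.var 12)))))
  (.setVar 12 (.add (.var 12) (.const 1)))

/-- There is a node left. -/
def labelTest : Test := .nle (.add (.var 12) (.const 2)) (.add (.var 0) (.var 0))

/-- Compute the labels of all nodes. -/
def labelCmd : Cmd := .seq (.setVar 12 (.const 0)) (.loop labelTest labelStep)

/-- A bound for the number of operations of `labelCmd`. -/
def labelCost (n : ℕ) : ℕ :=
  (Cmd.setVar 12 (.const 0)).maxCost +
    ((n + n) * (labelStep.maxCost + labelTest.cost) + labelTest.cost)

/-- Labels are computed in increasing order, so that of the parent is known. At the root the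
convention `p 0 = 0` makes the rule return the entry already there, and a root in the cut also gets
the label `0`. -/
theorem IsLabelling.update {p : ℕ → ℕ} {C : Finset ℕ} {N : ℕ} {lab : ℕ → ℕ} {v : ℕ}
    (h : IsLabelling p C N lab) (hp0 : p 0 = 0) (hp : ∀ x, 0 < x → p x < x)
    (hv : (N ∈ C ∧ v = N) ∨ (N ∉ C ∧ v = lab (p N))) :
    IsLabelling p C (N + 1) (Function.update lab N v) := by
  refine ⟨?_, ?_, ?_⟩
  · by_cases hN : N = 0
    · subst hN
      rw [Function.update_self]
      rcases hv with hv | hv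
      · exact hv.2
      · rw [hv.2, hp0, h.zero]
    · rw [Function.update_of_ne (Ne.symm hN), h.zero]
  · intro x hx hxC
    by_cases hxN : x = N
    · subst hxN
      rw [Function.update_self]
      tauto
    · rw [Function.update_of_ne hxN]
      exact h.of_mem x (by omega) hxC
  · intro x hx h0 hxC
    have h1 := hp x h0
    rw [Function.update_of_ne (show p x ≠ N by omega)]
    by_cases hxN : x = N
    · subst hxN
      rw [Function.update_self]
      tauto
    · rw [Function.update_of_ne hxN]
      exact h.of_notMem x (by omega) h0 hxC

theorem runs_label {n : ℕ} {P ei : ℕ → ℕ} {C : Finset ℕ} (hn : 0 < n) (hP0 : P 0 = 0)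
    (hP : ∀ x, 0 < x → P x < x) {s : State} (h0 : s.nvar 0 = n) (hPs : s.narr 4 = P)
    (hei : s.narr 7 = ei) (hC : ∀ x, s.narr 8 x ≠ 0 ↔ x ∈ C) (hlab : s.narr 9 = 0) :
    Runs labelCmd s (labelCost n) fun s' => s'.nvar 0 = n ∧ s'.narr 7 = ei ∧
      IsLabelling P C (2 * (n - 1) + 1) (s'.narr 9) := by
  set I : ℕ → State → Prop := fun k s' => s'.nvar 0 = n ∧ s'.narr 4 = P ∧ s'.narr 7 = ei ∧
    (∀ x, s'.narr 8 x ≠ 0 ↔ x ∈ C) ∧ s'.nvar 12 + k = n + n ∧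
    IsLabelling P C (s'.nvar 12) (s'.narr 9) with hI
  refine Runs.seq (R := I (n + n)) (Runs.loopFree (by exact trivial) ?_) fun s' hs' =>
    Runs.loop I ?_ ?_ (n + n) s' hs'
  · refine ⟨by simpa [Cmd.post] using h0, hPs, hei, hC, by simp [Cmd.post, NExp.val], ?_⟩
    simp only [Cmd.post, NExp.val, Function.update_self, hlab]
    exact ⟨rfl, by simp, by simp⟩
  · rintro k s ⟨h1, h2, h3, h4, h5, h6⟩ hb
    simp only [labelTest, Test.Holds, NExp.val, h1] at hb
    refine ⟨k - 1, by omega, Runs.loopFree (by simp [Cmd.LoopFree, labelStep]) ?_⟩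
    have h4' := h4 (s.nvar 12)
    by_cases hcut : s.nvar 12 ∈ C
    · have h7 : 1 ≤ s.narr 8 (s.nvar 12) := Nat.one_le_iff_ne_zero.2 (h4'.2 hcut)
      have hT : (Test.nle (.const 1) (.read 8 (.var 12))).Holds s := h7
      rw [labelStep, Cmd.post, Cmd.post_ite_pos hT]
      simp only [Cmd.post, NExp.val]
      refine ⟨by simpa using h1, by simpa using h2, by simpa using h3, by simpa using h4, ?_, ?_⟩
      · simp only [Function.update_self]; omega
      · simpa using IsLabelling.update h6 hP0 hP (Or.inl ⟨hcut, rfl⟩)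
    · have h7 : ¬ 1 ≤ s.narr 8 (s.nvar 12) := fun h => hcut (h4'.1 (by omega))
      have hT : ¬ (Test.nle (.const 1) (.read 8 (.var 12))).Holds s := h7
      rw [labelStep, Cmd.post, Cmd.post_ite_neg hT]
      simp only [Cmd.post, NExp.val]
      refine ⟨by simpa using h1, by simpa using h2, by simpa using h3, by simpa using h4, ?_, ?_⟩
      · simp only [Function.update_self]; omega
      · simpa [h2] using IsLabelling.update h6 hP0 hP (Or.inr ⟨hcut, rfl⟩)
  · rintro k s ⟨h1, h2, h3, h4, h5, h6⟩ hb
    simp only [labelTest, Test.Holds, NExp.val, h1] at hb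
    -- The test admits the nodes `0, …, 2 * n - 2`, which are all nodes of the subdivided tree.
    have hle : 2 * (n - 1) + 1 ≤ s.nvar 12 := by omega
    exact ⟨h1, h3, h6.zero, fun x hx => h6.of_mem x (hx.trans_le hle),
      fun x hx => h6.of_notMem x (hx.trans_le hle)⟩

/-! ### Writing the output -/

/-- Write the label of the edge number `nvar 3`. -/
def outputStep : Cmd :=
  .seq (.setNat 2 (.read 7 (.var 3)) (.read 9 (.add (.add (.var 3) (.var 3)) (.const 1))))
    (.setVar 3 (.add (.var 3) (.const 1)))

/-- There is an edge left. -/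
def outputTest : Test := .nle (.add (.var 3) (.const 2)) (.var 0)

/-- Write the labels of all edges in the order of the list. -/
def outputCmd : Cmd := .seq (.setVar 3 (.const 0)) (.loop outputTest outputStep)

/-- A bound for the number of operations of `outputCmd`. -/
def outputCost (n : ℕ) : ℕ :=
  (Cmd.setVar 3 (.const 0)).maxCost +
    (n * (outputStep.maxCost + outputTest.cost) + outputTest.cost)

/-- Injectivity of `ei`, which maps edge numbers to list positions, ensures that no written label is
overwritten. -/
theorem runs_output {n : ℕ} {ei lab : ℕ → ℕ}
    (hinj : ∀ i < n - 1, ∀ j < n - 1, ei i = ei j → i = j) {s : State} (h0 : s.nvar 0 = n)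
    (hei : s.narr 7 = ei) (hlab : s.narr 9 = lab) :
    Runs outputCmd s (outputCost n) fun s' => ∀ k < n - 1, s'.narr 2 (ei k) = lab (2 * k + 1) := by
  set I : ℕ → State → Prop := fun k s' => s'.nvar 0 = n ∧ s'.narr 7 = ei ∧ s'.narr 9 = lab ∧
    s'.nvar 3 + k = n ∧ ∀ j < s'.nvar 3, j < n - 1 → s'.narr 2 (ei j) = lab (2 * j + 1) with hI
  refine Runs.seq (R := I n) (Runs.loopFree (by exact trivial) ?_) fun s' hs' =>
    Runs.loop I ?_ ?_ n s' hs'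
  · refine ⟨by simpa [Cmd.post] using h0, hei, hlab, by simp [Cmd.post, NExp.val], ?_⟩
    simp [Cmd.post, NExp.val]
  · rintro k s ⟨h1, h2, h3, h4, h5⟩ hb
    simp only [outputTest, Test.Holds, NExp.val, h1] at hb
    refine ⟨k - 1, by omega, Runs.loopFree (by simp [Cmd.LoopFree, outputStep]) ?_⟩
    simp only [outputStep, Cmd.post, NExp.val]
    refine ⟨by simpa using h1, by simpa using h2, by simpa using h3, ?_, ?_⟩
    · simp only [Function.update_self]; omega
    · simp only [Function.update_self, h2, h3]
      intro j hj hjn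
      rcases Nat.lt_succ_iff_lt_or_eq.1 hj with hj | rfl
      · rw [Function.update_of_ne fun h => hj.ne (hinj _ hjn _ (by omega) h)]
        exact h5 j hj hjn
      · rw [Function.update_self, two_mul]
  · rintro k s ⟨h1, h2, h3, h4, h5⟩ hb
    simp only [outputTest, Test.Holds, NExp.val, h1] at hb
    exact fun k hk => h5 k (by omega) hk

end RealRAM

/-! ### The program -/

namespace RealRAM

open TreeDrawing TreeMulticut

/-- Decompose the tree. -/
def decomposeCmd : Cmd := .seq numberCmd (.seq cutAllCmd (.seq labelCmd outputCmd))

/-- A bound for the number of operations of `decomposeCmd`. -/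
def decomposeCost (n : ℕ) : ℕ :=
  numberCost n + (cutAllCost n + (labelCost n + outputCost n))

theorem polyBounded_decomposeCost : PolyBounded decomposeCost := by
  have hclimb : ∀ a u c, PolyBounded (climbCost a u c) := fun a u c =>
    (PolyBounded.const _).add
      (((PolyBounded.id.add .id).mul ((PolyBounded.const _).add (.const _))).add (.const _))
  have hpass : PolyBounded passCost := (PolyBounded.const _).add
    ((PolyBounded.id.mul ((PolyBounded.const _).add (.const _))).add (.const _))
  have hnumber : PolyBounded numberCost := (PolyBounded.const _).add
    ((PolyBounded.id.mul (((PolyBounded.const _).add hpass).add (.const _))).add (.const _))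
  have hpair : PolyBounded pairCost := (PolyBounded.const _).add
    (((hclimb _ _ _).add ((hclimb _ _ _).add (.const _))).add (.const _))
  have hrow : PolyBounded rowCost := (PolyBounded.const _).add
    ((PolyBounded.id.mul (((PolyBounded.const _).add hpair).add (.const _))).add (.const _))
  have hnode : PolyBounded nodeCost := (PolyBounded.const _).add
    ((PolyBounded.id.mul (((PolyBounded.const _).add hrow).add (.const _))).add (.const _))
  have hcut : PolyBounded cutAllCost := (PolyBounded.const _).add
    (((PolyBounded.id.add .id).mul (((PolyBounded.const _).add hnode).add (.const _))).add
      (.const _))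
  have hlabel : PolyBounded labelCost := (PolyBounded.const _).add
    (((PolyBounded.id.add .id).mul ((PolyBounded.const _).add (.const _))).add (.const _))
  have houtput : PolyBounded outputCost := (PolyBounded.const _).add
    ((PolyBounded.id.mul ((PolyBounded.const _).add (.const _))).add (.const _))
  exact hnumber.add (hcut.add (hlabel.add houtput))

/-- Once no edge joins a vertex with number to one without number, all vertices have numbers, and
the numbering is a rooting of the tree. -/
theorem Numbered.isRooting {n : ℕ} (hn : 0 < n) {G : SimpleGraph (Fin n)} [DecidableRel G.Adj]
    (hG : G.IsTree) {ends : Fin (n - 1) → Fin n × Fin n}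
    (hends : Set.BijOn (fun i => s((ends i).1, (ends i).2)) Set.univ G.edgeSet)
    {E₀ E₁ idx P X Y ei : ℕ → ℕ} {k : ℕ} (hE₀ : ∀ i : Fin (n - 1), E₀ i = (ends i).1)
    (hE₁ : ∀ i : Fin (n - 1), E₁ i = (ends i).2)
    (h : Numbered n E₀ E₁ idx P X Y ei k) (hclosed : NoCrossing (n - 1) E₀ E₁ idx) :
    ∃ (y : ℕ → Fin n) (q : ℕ → ℕ), IsRooting G (n - 1) y q P ∧
      (∀ j < n - 1, Y (j + 1) = y (j + 1) ∧ X j = y (q j)) ∧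
      ∀ j < n - 1, ∃ i : Fin (n - 1), ei j = i ∧
        s(y (q j), y (j + 1)) = s((ends i).1, (ends i).2) := by
  have hall : ∀ v : Fin n, idx v ≠ 0 := by
    -- Being numbered spreads along edges, and the tree is connected, so one numbered vertex
    -- suffices.
    have hwalk : ∀ a b : Fin n, G.Walk a b → idx b ≠ 0 → idx a ≠ 0 := by
      intro a b w
      induction w with
      | nil => exact id
      | @cons a c b hac _ ih =>
        intro hb hidx
        obtain ⟨i, -, hi⟩ := hends.surjOn ((SimpleGraph.mem_edgeSet G).2 hac)
        have hc := hclosed i i.2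
        rw [hE₀, hE₁] at hc
        rcases Sym2.eq_iff.1 hi with ⟨h1, h2⟩ | ⟨h1, h2⟩
        · rw [h1, h2] at hc
          exact ih hb (hc.1 hidx)
        · rw [h1, h2] at hc
          exact ih hb (hc.2 hidx)
    intro v
    have h0 := h.idx_Y 0 (Nat.zero_le _)
    obtain ⟨w⟩ := hG.connected.preconnected v ⟨Y 0, h0.1⟩
    exact hwalk _ _ w (by simp [h0.2])
  have hk : k = n - 1 := by
    have h1 := h.lt
    have h2 : (Finset.univ : Finset (Fin n)).card ≤ (Finset.range (k + 1)).card := by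
      refine Finset.card_le_card_of_injOn (fun v => idx v - 1) (fun v _ => ?_)
        fun v _ w _ hvw => ?_
      · have := (h.Y_idx v (hall v)).1
        have := hall v
        simp only [Finset.coe_range, Set.mem_Iio]
        omega
      · have hv := (h.Y_idx v (hall v)).2
        have hw := (h.Y_idx w (hall w)).2
        have hvw : idx v - 1 = idx w - 1 := hvw
        rw [hvw] at hv
        exact Fin.ext (hv.symm.trans hw)
    simp at h2
    omega
  subst hk
  set y : ℕ → Fin n := fun j => if hj : Y j < n then ⟨Y j, hj⟩ else ⟨0, hn⟩ with hy
  set q : ℕ → ℕ := fun j => idx (X j) - 1 with hq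
  have hyY : ∀ j ≤ n - 1, (y j : ℕ) = Y j := fun j hj => by
    simp only [hy, dif_pos (h.idx_Y j hj).1]
  have hqle : ∀ j < n - 1, q j ≤ j := fun j hj => by
    have := (h.parent j hj).2.1
    simp only [hq]
    omega
  have hX : ∀ j < n - 1, X j = y (q j) := fun j hj => by
    rw [hyY _ ((hqle j hj).trans hj.le)]
    exact ((h.Y_idx _ (h.parent j hj).1).2).symm
  have hinj : ∀ i ≤ n - 1, ∀ j ≤ n - 1, y i = y j → i = j := by
    intro i hi j hj hij
    have hY : Y i = Y j := by rw [← hyY i hi, ← hyY j hj, hij]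
    have h1 := (h.idx_Y i hi).2
    have h2 := (h.idx_Y j hj).2
    rw [hY] at h1
    omega
  have hedge : ∀ j < n - 1, ∃ i : Fin (n - 1), ei j = i ∧
      s(y (q j), y (j + 1)) = s((ends i).1, (ends i).2) := by
    intro j hj
    obtain ⟨h1, h2⟩ := h.edge j hj
    refine ⟨⟨ei j, h1⟩, rfl, ?_⟩
    have e0 := hE₀ ⟨ei j, h1⟩
    have e1 := hE₁ ⟨ei j, h1⟩
    simp only at e0 e1
    rw [e0, e1, hX j hj, ← hyY (j + 1) (by omega)] at h2
    rcases h2 with ⟨h2, h3⟩ | ⟨h2, h3⟩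
    · rw [Fin.ext h2, Fin.ext h3]
    · rw [Fin.ext h2, Fin.ext h3, Sym2.eq_swap]
  have hmem : ∀ j < n - 1, s(y (q j), y (j + 1)) ∈ G.edgeSet := fun j hj => by
    obtain ⟨i, -, hi⟩ := hedge j hj
    rw [hi]
    exact hends.mapsTo (Set.mem_univ i)
  refine ⟨y, q, ⟨hqle, hinj, ?_, hmem, ?_, ?_, ?_⟩, fun j hj => ⟨(hyY _ (by omega)).symm, hX j hj⟩,
    hedge⟩
  · intro v
    have h1 := h.Y_idx v (hall v)
    refine ⟨idx v - 1, by omega, Fin.ext ?_⟩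
    rw [hyY _ (by omega), h1.2]
  · intro e he
    -- The numbered edges are `n - 1` distinct edges of a tree with `n - 1` edges, so none is
    -- missing.
    have hsurj := Finset.surjOn_of_injOn_of_card_le (s := Finset.range (n - 1))
      (t := G.edgeFinset) (fun j => s(y (q j), y (j + 1)))
      (fun j hj => by simpa using hmem j (by simpa using hj))
      (fun i hi j hj hij => parent_edge_inj hqle hinj (by simpa using hi) (by simpa using hj) hij)
      (by
        have := hG.card_edgeFinset
        simp only [Fintype.card_fin] at this
        simp only [Finset.card_range]
        omega)
    obtain ⟨j, hj, hje⟩ := hsurj (SimpleGraph.mem_edgeFinset.2 he : e ∈ G.edgeFinset)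
    exact ⟨j, by simpa using hj, hje⟩
  · exact fun j hj => (h.parent j hj).2.2.2
  · exact fun j hj => (h.parent j hj).2.2.1

/-- The program computes a decomposition with fewer than twice the optimal number of parts. -/
theorem runs_decompose {n : ℕ} (hn : 2 ≤ n) {G : SimpleGraph (Fin n)} [DecidableRel G.Adj]
    (hG : G.IsTree) {pos : Fin n → Plane} (hpos : Function.Injective pos)
    {ends : Fin (n - 1) → Fin n × Fin n}
    (hends : Set.BijOn (fun i => s((ends i).1, (ends i).2)) Set.univ G.edgeSet) :
    Runs decomposeCmd (inputState n ends pos) (decomposeCost n) fun s =>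
      ∃ P : Finpartition G.edgeFinset, OutputsPartition s ends P ∧ IsProperDecomposition pos P ∧
        (P.parts.card : ℤ) ≤ 2 * (optSize G pos : ℤ) - 1 := by
  classical
  have : Nontrivial (Fin n) := Fin.nontrivial_iff_two_le.2 hn
  set s₀ := inputState n ends pos with hs₀
  have hE₀ : ∀ i : Fin (n - 1), s₀.narr 0 i = (ends i).1 := fun i => by simp [hs₀, inputState]
  have hE₁ : ∀ i : Fin (n - 1), s₀.narr 1 i = (ends i).2 := fun i => by simp [hs₀, inputState]
  have hpoint : ∀ v : Fin n, point s₀.rarr v = pos v := fun v => by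
    ext i
    fin_cases i <;> simp [point, hs₀, inputState]
  refine Runs.seq (runs_number (by omega) (E₀ := s₀.narr 0) (E₁ := s₀.narr 1) (R := s₀.rarr)
    (fun i hi => ?_) (by simp [hs₀, inputState]) (by simp [hs₀, inputState]) rfl rfl
    (fun a ha => ?_) rfl) ?_
  · have h0 := hE₀ ⟨i, hi⟩
    have h1 := hE₁ ⟨i, hi⟩
    simp only at h0 h1
    rw [h0, h1]
    exact ⟨Fin.is_lt _, Fin.is_lt _⟩
  · funext i
    have h0 : a ≠ 0 := by omega
    have h1 : a ≠ 1 := by omega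
    simp [hs₀, inputState, h0, h1]
  rintro s₁ ⟨hN, hclosed⟩
  obtain ⟨y, q, hR, hXY, hei⟩ := hN.numbered.isRooting (by omega) hG hends hE₀ hE₁ hclosed
  set P := s₁.narr 4 with hP
  set X := s₁.narr 5 with hX
  set Y := s₁.narr 6 with hY
  set ei := s₁.narr 7 with heidef
  have hPlt := hN.numbered.P_lt
  have hconf : NodeConflict (n - 1) X Y s₀.rarr = EdgeConflict pos (n - 1) y q := by
    funext a b
    refine propext (exists_congr fun i => and_congr_right fun hi => exists_congr fun j =>
      and_congr_right fun hj => ?_)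
    rw [(hXY i hi).1, (hXY i hi).2, (hXY j hj).1, (hXY j hj).2, hpoint, hpoint, hpoint, hpoint]
  refine Runs.seq (runs_cutAll (γ := Finset (Sym2 (Fin n))) (by omega) hPlt
    ⟨hN.n_eq, hP.symm, hX.symm, hY.symm, heidef.symm, hN.lab_eq, hN.R_eq⟩ hN.cut_eq) ?_
  rintro s₂ ⟨hF, C, hC, hI⟩
  rw [hconf] at hI
  refine Runs.seq (runs_label (by omega) hN.numbered.P_zero hPlt hF.n_eq hF.P_eq hF.ei_eq hC
    hF.lab_eq) ?_
  rintro s₃ ⟨hn₃, hei₃, hlab⟩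
  have heinj : ∀ i < n - 1, ∀ j < n - 1, ei i = ei j → i = j := by
    intro i hi j hj hij
    obtain ⟨a, ha, hae⟩ := hei i hi
    obtain ⟨b, hb, hbe⟩ := hei j hj
    have hab : a = b := Fin.ext (ha.symm.trans (hij.trans hb))
    subst hab
    exact hR.edge_inj hi hj (hae.trans hbe.symm)
  refine (runs_output heinj hn₃ hei₃ rfl).mono le_rfl fun s hout => ?_
  -- The label of an edge is read off at its position in the list, which is unique since the list is
  -- a bijection; outside the list the value is irrelevant.
  let ℓ : Sym2 (Fin n) → ℕ := fun e =>
    if h : ∃ i : Fin (n - 1), s((ends i).1, (ends i).2) = e then s.narr 2 h.choose else 0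
  have hℓ : ∀ i : Fin (n - 1), ℓ s((ends i).1, (ends i).2) = s.narr 2 i := by
    intro i
    have hex : ∃ j : Fin (n - 1), s((ends j).1, (ends j).2) = s((ends i).1, (ends i).2) := ⟨i, rfl⟩
    have : hex.choose = i := hends.injOn (Set.mem_univ _) (Set.mem_univ _) hex.choose_spec
    simp only [ℓ, dif_pos hex, this]
  have hℓ' : ∀ k < n - 1, ℓ s(y (q k), y (k + 1)) = s₃.narr 9 (2 * k + 1) := by
    intro k hk
    obtain ⟨i, hi, hie⟩ := hei k hk
    rw [hie, hℓ, ← hi, hout k hk]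
  have hmain := greedy_approximation hpos hG hR hPlt hlab hℓ' hI
  refine ⟨fibrePartition G.edgeFinset ℓ, fun i j => ?_, hmain⟩
  have hE : ∀ i : Fin (n - 1), s((ends i).1, (ends i).2) ∈ G.edgeFinset := fun i =>
    SimpleGraph.mem_edgeFinset.2 (hends.mapsTo (Set.mem_univ i))
  rw [exists_mem_fibrePartition_iff (hE i) (hE j), hℓ, hℓ]

end RealRAM

theorem mainTheorem7 :
    ∃ (prog : RealRAM.Cmd) (p : Polynomial ℕ),
      ∀ (n : ℕ), 2 ≤ n →
      ∀ (G : SimpleGraph (Fin n)) [DecidableRel G.Adj], G.IsTree →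
      ∀ (pos : Fin n → TreeDrawing.Plane), TreeDrawing.IsPlaneDrawing G pos →
      ∀ (ends : Fin (n - 1) → Fin n × Fin n),
        Set.BijOn (fun i => s((ends i).1, (ends i).2)) Set.univ G.edgeSet →
      ∃ (t : ℕ) (s : RealRAM.State) (P : Finpartition G.edgeFinset),
        RealRAM.Exec prog (RealRAM.inputState n ends pos) t s ∧
        t ≤ p.eval n ∧
        RealRAM.OutputsPartition s ends P ∧
        TreeDrawing.IsProperDecomposition pos P ∧
        (P.parts.card : ℤ) ≤ 2 * (TreeDrawing.optSize G pos : ℤ) - 1 := by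
  obtain ⟨p, hp⟩ := RealRAM.polyBounded_decomposeCost
  refine ⟨RealRAM.decomposeCmd, p, fun n hn G _ hG pos hpos ends hends => ?_⟩
  obtain ⟨t, s, hexec, ht, P, hP⟩ := RealRAM.runs_decompose hn hG hpos.injective hends
  exact ⟨t, s, P, hexec, ht.trans (hp n), hP⟩
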